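/- Let $\mathbb{G}$ be a compact quantum group: a separable unital $C^*$-algebra $C(\mathbb{G})\neq 0$ with a coassociative unital $*$-homomorphism $\Delta\colon C(\mathbb{G})\to C(\mathbb{G})\otimes C(\mathbb{G})$ (minimal tensor product) such that the linear spans of $\Delta(C(\mathbb{G}))(C(\mathbb{G})\otimes 1)$ and of $\Delta(C(\mathbb{G}))(1\otimes C(\mathbb{G}))$ are dense. Let $\alpha=(\alpha_{ij})\in M_d(C(\mathbb{G}))$ be a unitary representation of $\mathbb{G}$ on $\mathscr{H}=\mathbb{C}^d$: $\alpha$ is a unitary matrix with $\Delta(\alpha_{ij})=\sum_k\alpha_{ik}\otimes\alpha_{kj}$. Let $\alpha^k$ be its $k$-fold tensor power. Let $\mathcal{O}_d$ be the Cuntz algebra, i.e. the universal unital $C^*$-algebra generated by $S_1,\dots,S_d$ with $S_i^*S_j=\delta_{ij}$ and $\sum_j S_jS_j^*=1$. Put $$\mathscr{H}^{\ell}(\mathscr{H}^*)^{k}=\mathrm{span}\{S_{i_1}\cdots S_{i_\ell}S_{j_1}^*\cdots S_{j_k}^*\}\subseteq\mathcal{O}_d .$$ Let $\delta\colon\mathcal{O}_d\to\mathcal{O}_d\otimes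 C(\mathbb{G})$ be the action of $\mathbb{G}$ given by $\delta(S_i)=\sum_j S_j\otimes\alpha_{ji}$, let $\gamma$ be the gauge action of the circle, $\gamma_z(S_j)=zS_j$, and let $$\mathcal{O}_d^\alpha=\{T\in\mathcal{O}_d:\delta(T)=T\otimes 1\},\qquad \mathcal{F}^\alpha=\{T\in\mathcal{O}_d^\alpha:\gamma_z(T)=T\text{ for all }|z|=1\}.$$ A $C^*$-correspondence over a unital $C^*$-algebra $A$ is a right Hilbert $A$-module $E$ with a unital $*$-homomorphism $\phi$ from $A$ to the adjointable operators on $E$; a finite frame of $E$ is a finite family $(\xi_i)$ in $E$ with $\sum_i\xi_i\langle\xi_i,\xi\rangle=\xi$ for all $\xi\in E$. A compatible representation of $E$ (with frame $(\xi_i)$) on a $C^*$-algebra $B$ is a pair of a $*$-homomorphism $\pi\colon A\to B$ and a linear map $t\colon E\to B$ such that $t(\xi)^*t(\eta)=\pi(\langle\xi,\eta\rangle)$, $\pi(a)t(\xi)=t(\phi(a)\xi)$ and $\sum_i t(\xi_i)t(\xi_i)^*=\pi(1)$. The Cuntz–Pimsner algebra $\mathcal{O}_E$ is the $C^*$-algebra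 carrying the universal compatible representation: every compatible representation of $E$ on a $C^*$-algebra $B$ factors through it by a unique $*$-homomorphism $\mathcal{O}_E\to B$. **Proposition.** Let $N\in\mathbb{N}$ be such that $\alpha^N$ is contained in $\alpha^{N+1}$. Then: 1. There is an isometry $\nu\in\mathscr{H}^{N+1}(\mathscr{H}^*)^{N}\cap\mathcal{O}_d^\alpha$. 2. For every such isometry $\nu$, the algebra $\mathcal{O}_d^\alpha$ is isomorphic to the Cuntz–Pimsner algebra $\mathcal{O}_E$ of the $C^*$-correspondence $E=\nu^*\mathcal{F}^\alpha$ over $\mathcal{F}^\alpha$, where the left and right actions are given by multiplication in $\mathcal{O}_d$ and $\langle\xi,\eta\rangle=\xi^*\eta$, with the one-element frame $\nu^*$. More precisely, the inclusions $\mathcal{F}^\alpha\subseteq\mathcal{O}_d^\alpha$ and $E\subseteq\mathcal{O}_d^\alpha$ form a universal compatible representation of $E$. -/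

import Mathlib

noncomputable section

open scoped TensorProduct

theorem starAlgHom_continuous {A C : Type*} [CStarAlgebra A] [CStarAlgebra C] (f : A →⋆ₐ[ℂ] C) :
    Continuous f :=
  AddMonoidHomClass.continuous_of_bound f 1
    (fun x => by rw [one_mul]; exact NonUnitalStarAlgHom.norm_apply_le f x)

/-! ### C*-completions of complex star-algebras -/

/-- A C*-seminorm on a unital complex `*`-algebra. -/
structure CStarSeminorm (P : Type*) [Ring P] [StarRing P] [Algebra ℂ P] extends Seminorm ℂ P where
  mul_le' : ∀ x y : P, toFun (x * y) ≤ toFun x * toFun y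
  star_mul_self' : ∀ x : P, toFun (star x * x) = toFun x ^ 2

namespace CStarSeminorm

variable {P : Type*} [Ring P] [StarRing P] [Algebra ℂ P]

instance : CoeFun (CStarSeminorm P) (fun _ => P → ℝ) := ⟨fun p => p.toSeminorm⟩

theorem mul_le (p : CStarSeminorm P) (x y : P) : p (x * y) ≤ p x * p y := p.mul_le' x y

theorem star_mul_self (p : CStarSeminorm P) (x : P) : p (star x * x) = p x ^ 2 :=
  p.star_mul_self' x

theorem nonneg (p : CStarSeminorm P) (x : P) : 0 ≤ p x := apply_nonneg p.toSeminorm x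

theorem le_star (p : CStarSeminorm P) (x : P) : p x ≤ p (star x) := by
  have h1 : p x ^ 2 ≤ p (star x) * p x := by
    rw [← p.star_mul_self]; exact p.mul_le _ _
  by_contra h
  push Not at h
  have h2 := p.nonneg (star x)
  nlinarith

theorem star_eq (p : CStarSeminorm P) (x : P) : p (star x) = p x :=
  le_antisymm (by simpa using p.le_star (star x)) (p.le_star x)

/-- The C*-seminorm `x ↦ ‖f x‖` of a `*`-homomorphism into a C*-algebra. -/
def ofHom {C : Type*} [CStarAlgebra C] (f : P →⋆ₐ[ℂ] C) : CStarSeminorm P where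
  toFun x := ‖f x‖
  map_zero' := by simp
  add_le' x y := by rw [map_add]; exact norm_add_le _ _
  neg' x := by rw [map_neg, norm_neg]
  smul' c x := by rw [map_smul, norm_smul]
  mul_le' x y := by rw [map_mul]; exact norm_mul_le _ _
  star_mul_self' x := by
    simp only [map_mul, map_star, CStarRing.norm_star_mul_self, sq]

@[simp] theorem ofHom_apply {C : Type*} [CStarAlgebra C] (f : P →⋆ₐ[ℂ] C) (x : P) :
    ofHom f x = ‖f x‖ := rfl

/-- The pointwise supremum of a pointwise bounded set of C*-seminorms. -/
def sup (Q : Set (CStarSeminorm P)) (hQ : ∀ x : P, BddAbove (Set.range fun q : Q => q.1 x)) :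
    CStarSeminorm P where
  toFun x := ⨆ q : Q, q.1 x
  map_zero' := by
    have : ∀ q : Q, q.1 0 = 0 := fun q => map_zero q.1.toSeminorm
    simp [this]
  add_le' x y := by
    refine Real.iSup_le (fun q => ?_)
      (add_nonneg (Real.iSup_nonneg fun q => q.1.nonneg x) (Real.iSup_nonneg fun q => q.1.nonneg y))
    exact (map_add_le_add q.1.toSeminorm x y).trans
      (add_le_add (le_ciSup (hQ x) q) (le_ciSup (hQ y) q))
  neg' x := by
    have : ∀ q : Q, q.1 (-x) = q.1 x := fun q => map_neg_eq_map q.1.toSeminorm x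
    simp [this]
  smul' c x := by
    have : ∀ q : Q, q.1 (c • x) = ‖c‖ * q.1 x := fun q => map_smul_eq_mul q.1.toSeminorm c x
    simp only [this]
    exact (Real.mul_iSup_of_nonneg (norm_nonneg c) _).symm
  mul_le' x y := by
    have hx := Real.iSup_nonneg fun q : Q => q.1.nonneg x
    have hy := Real.iSup_nonneg fun q : Q => q.1.nonneg y
    refine Real.iSup_le (fun q => ?_) (mul_nonneg hx hy)
    exact (q.1.mul_le x y).trans
      (mul_le_mul (le_ciSup (hQ x) q) (le_ciSup (hQ y) q) (q.1.nonneg y) hx)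
  star_mul_self' x := by
    have hx := Real.iSup_nonneg fun q : Q => q.1.nonneg x
    apply le_antisymm
    · refine Real.iSup_le (fun q => ?_) (sq_nonneg _)
      rw [q.1.star_mul_self]
      exact pow_le_pow_left₀ (q.1.nonneg x) (le_ciSup (hQ x) q) 2
    · have h0 := Real.iSup_nonneg fun q : Q => q.1.nonneg (star x * x)
      rw [← Real.le_sqrt hx h0]
      refine Real.iSup_le (fun q => ?_) (Real.sqrt_nonneg _)
      apply Real.le_sqrt_of_sq_le
      rw [← q.1.star_mul_self]
      exact le_ciSup (hQ (star x * x)) q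

theorem sup_apply (Q : Set (CStarSeminorm P)) (hQ) (x : P) : sup Q hQ x = ⨆ q : Q, q.1 x := rfl

theorem le_sup {Q : Set (CStarSeminorm P)} (hQ) {q : CStarSeminorm P} (hq : q ∈ Q) (x : P) :
    q x ≤ sup Q hQ x := le_ciSup (hQ x) ⟨q, hq⟩

theorem sup_le {Q : Set (CStarSeminorm P)} (hQ) {x : P} {r : ℝ} (hr : 0 ≤ r)
    (h : ∀ q ∈ Q, q x ≤ r) : sup Q hQ x ≤ r := Real.iSup_le (fun q => h q.1 q.2) hr

/-- The `*`-algebra `P`, equipped with the seminorm `p`. -/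
def Carrier (_p : CStarSeminorm P) : Type _ := P

variable (p : CStarSeminorm P)

instance : Ring p.Carrier := inferInstanceAs (Ring P)
instance : Algebra ℂ p.Carrier := inferInstanceAs (Algebra ℂ P)
instance : StarRing p.Carrier := inferInstanceAs (StarRing P)
instance [StarModule ℂ P] : StarModule ℂ p.Carrier := inferInstanceAs (StarModule ℂ P)

/-- `p`, as a ring seminorm on `p.Carrier`. -/
def ringSeminorm : RingSeminorm p.Carrier where
  toFun := fun x : P => p x
  map_zero' := map_zero p.toSeminorm
  add_le' := map_add_le_add p.toSeminorm
  neg' := map_neg_eq_map p.toSeminorm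
  mul_le' := p.mul_le

instance : SeminormedRing p.Carrier := p.ringSeminorm.toSeminormedRing

theorem norm_def (x : p.Carrier) : ‖x‖ = p x := rfl

instance : NormedAlgebra ℂ p.Carrier where
  norm_smul_le c x := (map_smul_eq_mul p.toSeminorm c x).le

instance : NormedStarGroup p.Carrier where
  norm_star_le x := (p.star_eq x).le


open UniformSpace

/-- The canonical map from `P`, as a ring homomorphism. -/
def coeHom : P →+* Completion p.Carrier := (Completion.coeRingHom : p.Carrier →+* _)

theorem norm_coeHom (x : P) : ‖coeHom p x‖ = p x := Completion.norm_coe (E := p.Carrier) x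

theorem coeHom_smul (c : ℂ) (x : P) : coeHom p (c • x) = c • coeHom p x := by
  rw [Algebra.smul_def, map_mul, Algebra.smul_def]; rfl

theorem denseRange_coeHom : DenseRange (coeHom p) := Completion.denseRange_coe (α := p.Carrier)

theorem completion_induction {C : Completion p.Carrier → Prop} (hC : IsClosed {x | C x})
    (h : ∀ x : P, C (coeHom p x)) (x : Completion p.Carrier) : C x :=
  Completion.induction_on (α := p.Carrier) x hC h

theorem continuous_const_smul' (c : ℂ) : Continuous fun x : Completion p.Carrier => c • x := by
  simp only [Algebra.smul_def]
  exact continuous_const.mul continuous_id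

instance : NormedAlgebra ℂ (Completion p.Carrier) where
  norm_smul_le c x := by
    induction x using completion_induction with
    | hC => exact isClosed_le (continuous_const_smul' p c).norm (continuous_const.mul continuous_norm)
    | h x =>
      rw [← coeHom_smul, norm_coeHom, norm_coeHom]
      exact (map_smul_eq_mul p.toSeminorm c x).le

instance : Star (Completion p.Carrier) where
  star := Completion.map (star : p.Carrier → p.Carrier)

theorem continuous_star' : Continuous (star : Completion p.Carrier → Completion p.Carrier) :=
  Completion.continuous_map

theorem star_coeHom (x : P) : star (coeHom p x) = coeHom p (star x) :=
  Completion.map_coe (α := p.Carrier) (β := p.Carrier) (f := star)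
    (star_isometry (E := p.Carrier)).uniformContinuous x

instance : StarRing (Completion p.Carrier) where
  star_involutive x := by
    induction x using completion_induction with
    | hC => exact isClosed_eq ((continuous_star' p).comp (continuous_star' p)) continuous_id
    | h x => rw [star_coeHom, star_coeHom, star_star]
  star_mul x y := by
    induction x using completion_induction with
    | hC =>
      exact isClosed_eq ((continuous_star' p).comp (continuous_id.mul continuous_const))
        (continuous_const.mul (continuous_star' p))
    | h x =>
      induction y using completion_induction with
      | hC =>
        exact isClosed_eq ((continuous_star' p).comp (continuous_const.mul continuous_id))
          ((continuous_star' p).mul continuous_const)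
      | h y => simp only [← map_mul, star_coeHom, star_mul]
  star_add x y := by
    induction x using completion_induction with
    | hC =>
      exact isClosed_eq ((continuous_star' p).comp (continuous_id.add continuous_const))
        ((continuous_star' p).add continuous_const)
    | h x =>
      induction y using completion_induction with
      | hC =>
        exact isClosed_eq ((continuous_star' p).comp (continuous_const.add continuous_id))
          (continuous_const.add (continuous_star' p))
      | h y => simp only [← map_add, star_coeHom, star_add]

instance : CStarRing (Completion p.Carrier) where
  norm_mul_self_le x := by
    induction x using completion_induction with
    | hC =>
      exact isClosed_le (continuous_norm.mul continuous_norm)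
        ((continuous_star' p).mul continuous_id).norm
    | h x =>
      rw [star_coeHom, ← map_mul, norm_coeHom, norm_coeHom, p.star_mul_self, sq]

variable [StarModule ℂ P]

instance : StarModule ℂ (Completion p.Carrier) where
  star_smul c x := by
    induction x using completion_induction with
    | hC =>
      exact isClosed_eq ((continuous_star' p).comp (continuous_const_smul' p c))
        ((continuous_const_smul' p _).comp (continuous_star' p))
    | h x => simp only [← coeHom_smul, star_coeHom, star_smul]

instance : CStarAlgebra (Completion p.Carrier) where

end CStarSeminorm

/-- The C*-algebra obtained from a `*`-algebra `P` and a C*-seminorm `p` on it: the completion of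
`P` with respect to `p` (which includes the division by the null space of `p`). -/
def CStarCompletion {P : Type*} [Ring P] [StarRing P] [Algebra ℂ P] (p : CStarSeminorm P) :
    Type _ := UniformSpace.Completion p.Carrier

namespace CStarCompletion

open UniformSpace

section

variable {P : Type*} [Ring P] [StarRing P] [Algebra ℂ P] {p : CStarSeminorm P}
  {C : Type*} [CStarAlgebra C]

/-- A `*`-homomorphism on `P`, as a ring homomorphism on `p.Carrier`. -/
def carrierHom (p : CStarSeminorm P) (f : P →⋆ₐ[ℂ] C) : p.Carrier →+* C := (f : P →+* C)

theorem continuous_of_le {f : P →⋆ₐ[ℂ] C} (hf : ∀ x, ‖f x‖ ≤ p x) :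
    Continuous (carrierHom p f) :=
  AddMonoidHomClass.continuous_of_bound (f := carrierHom p f) 1
    (fun x => by rw [one_mul]; exact hf x)

end

variable {P : Type*} [Ring P] [StarRing P] [Algebra ℂ P] [StarModule ℂ P] (p : CStarSeminorm P)

instance : CStarAlgebra (CStarCompletion p) := inferInstanceAs (CStarAlgebra (Completion p.Carrier))

/-- The canonical `*`-homomorphism from `P` into its completion. -/
def of : P →⋆ₐ[ℂ] CStarCompletion p where
  __ := (p.coeHom : P →+* CStarCompletion p)
  commutes' _ := rfl
  map_star' x := (p.star_coeHom x).symm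

theorem norm_of (x : P) : ‖of p x‖ = p x := p.norm_coeHom x

theorem denseRange_of : DenseRange (of p) := p.denseRange_coeHom

variable {p} {C : Type*} [CStarAlgebra C]

theorem induction {Q : CStarCompletion p → Prop} (hQ : IsClosed {x | Q x})
    (h : ∀ x : P, Q (of p x)) (x : CStarCompletion p) : Q x :=
  p.completion_induction hQ h x

/-- A `*`-homomorphism on `P` that is dominated by `p` extends to the completion. -/
def lift (f : P →⋆ₐ[ℂ] C) (hf : ∀ x, ‖f x‖ ≤ p x) : CStarCompletion p →⋆ₐ[ℂ] C where
  __ := (Completion.extensionHom (carrierHom p f) (continuous_of_le hf) :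
    CStarCompletion p →+* C)
  commutes' c :=
    (Completion.extensionHom_coe (carrierHom p f) (continuous_of_le hf) (algebraMap ℂ P c)).trans
      (AlgHomClass.commutes f c)
  map_star' x := by
    induction x using CStarCompletion.induction with
    | hQ =>
      exact isClosed_eq (Completion.continuous_extension.comp continuous_star)
        (continuous_star.comp Completion.continuous_extension)
    | h x =>
      rw [← map_star (of p)]
      refine (Completion.extensionHom_coe (carrierHom p f) (continuous_of_le hf) (star x)).trans ?_
      refine Eq.trans ?_ (congrArg star
        (Completion.extensionHom_coe (carrierHom p f) (continuous_of_le hf) x)).symm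
      exact map_star f x

theorem lift_of (f : P →⋆ₐ[ℂ] C) (hf : ∀ x, ‖f x‖ ≤ p x) (x : P) : lift f hf (of p x) = f x :=
  Completion.extensionHom_coe (carrierHom p f) (continuous_of_le hf) x

theorem hom_ext {f g : CStarCompletion p →⋆ₐ[ℂ] C} (h : ∀ x, f (of p x) = g (of p x)) : f = g := by
  ext x
  induction x using CStarCompletion.induction with
  | hQ => exact isClosed_eq (starAlgHom_continuous f) (starAlgHom_continuous g)
  | h x => exact h x

end CStarCompletion

/-! ### The free star-algebra -/

/-- The free unital complex `*`-algebra on `X`: noncommutative polynomials in the letters `x` and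
their formal adjoints. -/
def FreeStarAlg (X : Type*) : Type _ := FreeAlgebra ℂ (X ⊕ X)

namespace FreeStarAlg

variable {X : Type*}

instance : Ring (FreeStarAlg X) := inferInstanceAs (Ring (FreeAlgebra ℂ (X ⊕ X)))
instance : Algebra ℂ (FreeStarAlg X) := inferInstanceAs (Algebra ℂ (FreeAlgebra ℂ (X ⊕ X)))

/-- A letter `x` (`Sum.inl x`) or its formal adjoint (`Sum.inr x`). -/
def letter (s : X ⊕ X) : FreeStarAlg X := FreeAlgebra.ι ℂ s

/-- The generator attached to `x`. -/
def gen (x : X) : FreeStarAlg X := letter (Sum.inl x)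

theorem induction {C : FreeStarAlg X → Prop} (h0 : ∀ r : ℂ, C (algebraMap ℂ _ r))
    (h1 : ∀ s, C (letter s)) (hm : ∀ a b, C a → C b → C (a * b))
    (ha : ∀ a b, C a → C b → C (a + b)) (a : FreeStarAlg X) : C a :=
  FreeAlgebra.induction ℂ (X ⊕ X) (motive := C) h0 h1 hm ha a

/-- The opposite algebra with the conjugate scalar multiplication. -/
abbrev conjOppAlgebra (X : Type*) : Algebra ℂ (FreeStarAlg X)ᵐᵒᵖ :=
  RingHom.toAlgebra' ((algebraMap ℂ (FreeStarAlg X)ᵐᵒᵖ).comp (starRingEnd ℂ))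
    (fun c x => Algebra.commutes (starRingEnd ℂ c) x)

/-- The conjugate linear antimultiplicative map exchanging each `x` with its formal adjoint. -/
def starHom (X : Type*) : FreeStarAlg X →+* (FreeStarAlg X)ᵐᵒᵖ :=
  letI := conjOppAlgebra X
  ((FreeAlgebra.lift ℂ (fun s : X ⊕ X => MulOpposite.op (letter s.swap)) :
    FreeAlgebra ℂ (X ⊕ X) →ₐ[ℂ] (FreeStarAlg X)ᵐᵒᵖ) : FreeAlgebra ℂ (X ⊕ X) →+* _)

theorem starHom_letter (s : X ⊕ X) : starHom X (letter s) = MulOpposite.op (letter s.swap) :=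
  letI := conjOppAlgebra X
  FreeAlgebra.lift_ι_apply (R := ℂ) (fun s : X ⊕ X => MulOpposite.op (letter s.swap)) s

theorem starHom_algebraMap (c : ℂ) :
    starHom X (algebraMap ℂ _ c) = MulOpposite.op (algebraMap ℂ _ (starRingEnd ℂ c)) :=
  letI := conjOppAlgebra X
  AlgHom.commutes (FreeAlgebra.lift ℂ (fun s : X ⊕ X => MulOpposite.op (letter s.swap)) :
    FreeAlgebra ℂ (X ⊕ X) →ₐ[ℂ] (FreeStarAlg X)ᵐᵒᵖ) c

instance : Star (FreeStarAlg X) where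
  star a := (starHom X a).unop

theorem star_letter (s : X ⊕ X) : star (letter s) = letter s.swap :=
  congrArg MulOpposite.unop (starHom_letter s)

theorem star_algebraMap' (c : ℂ) :
    star (algebraMap ℂ (FreeStarAlg X) c) = algebraMap ℂ _ (starRingEnd ℂ c) :=
  congrArg MulOpposite.unop (starHom_algebraMap c)

theorem star_add' (a b : FreeStarAlg X) : star (a + b) = star a + star b :=
  congrArg MulOpposite.unop (map_add (starHom X) a b)

theorem star_mul' (a b : FreeStarAlg X) : star (a * b) = star b * star a :=
  congrArg MulOpposite.unop (map_mul (starHom X) a b)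

instance : StarRing (FreeStarAlg X) where
  star_involutive a := by
    induction a using FreeStarAlg.induction with
    | h0 r => simp [star_algebraMap']
    | h1 s => simp [star_letter]
    | hm a b ha hb => rw [star_mul', star_mul', ha, hb]
    | ha a b ha hb => rw [star_add', star_add', ha, hb]
  star_mul := star_mul'
  star_add := star_add'

instance : StarModule ℂ (FreeStarAlg X) where
  star_smul c a := by
    rw [Algebra.smul_def, star_mul, star_algebraMap', Algebra.smul_def]
    exact (Algebra.commutes _ _).symm

variable {C : Type*} [CStarAlgebra C]

/-- The algebra homomorphism underlying `lift`. -/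
def liftAlg (T : X → C) : FreeStarAlg X →ₐ[ℂ] C :=
  (FreeAlgebra.lift ℂ (Sum.elim T (fun x => star (T x))) : FreeAlgebra ℂ (X ⊕ X) →ₐ[ℂ] C)

theorem liftAlg_letter (T : X → C) (s : X ⊕ X) :
    liftAlg T (letter s) = Sum.elim T (fun x => star (T x)) s :=
  FreeAlgebra.lift_ι_apply _ _

theorem liftAlg_star (T : X → C) (a : FreeStarAlg X) : liftAlg T (star a) = star (liftAlg T a) := by
  induction a using FreeStarAlg.induction with
  | h0 r => rw [star_algebraMap', AlgHom.commutes, AlgHom.commutes]; exact algebraMap_star_comm r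
  | h1 s => rw [star_letter, liftAlg_letter, liftAlg_letter]; cases s <;> simp
  | hm a b ha hb => rw [star_mul, map_mul, map_mul, star_mul, ha, hb]
  | ha a b ha hb => rw [star_add, map_add, map_add, star_add, ha, hb]

/-- The `*`-homomorphism with prescribed values at the generators. -/
def lift (T : X → C) : FreeStarAlg X →⋆ₐ[ℂ] C where
  __ := liftAlg T
  map_star' := liftAlg_star T

@[simp] theorem lift_gen (T : X → C) (x : X) : lift T (gen x) = T x :=
  liftAlg_letter T (Sum.inl x)

theorem hom_ext {f g : FreeStarAlg X →⋆ₐ[ℂ] C} (h : ∀ x, f (gen x) = g (gen x)) : f = g := by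
  ext a
  induction a using FreeStarAlg.induction with
  | h0 r => exact (AlgHomClass.commutes f r).trans (AlgHomClass.commutes g r).symm
  | h1 s =>
    cases s with
    | inl x => exact h x
    | inr x =>
      have : letter (Sum.inr x) = star (gen x) := (star_letter (Sum.inl x)).symm
      rw [this, map_star, map_star, h]
  | hm a b ha hb => rw [map_mul, map_mul, ha, hb]
  | ha a b ha hb => rw [map_add, map_add, ha, hb]

end FreeStarAlg

/-! ### The Cuntz algebra -/

/-- The Cuntz relations `Sᵢ* Sⱼ = δᵢⱼ` and `∑ⱼ Sⱼ Sⱼ* = 1` for a family in a `*`-ring. -/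
structure IsCuntzFamily {d : ℕ} {C : Type*} [Ring C] [StarRing C] (T : Fin d → C) : Prop where
  star_mul : ∀ i j, star (T i) * T j = if i = j then 1 else 0
  sum_mul_star : ∑ j, T j * star (T j) = 1

/-- The C*-seminorms on the free `*`-algebra on `d` letters in which the Cuntz relations hold. -/
def cuntzSeminorms (d : ℕ) : Set (CStarSeminorm (FreeStarAlg (Fin d))) :=
  {q | (∀ i j, q (star (FreeStarAlg.gen i) * FreeStarAlg.gen j - if i = j then 1 else 0) = 0) ∧
    q (∑ j, FreeStarAlg.gen j * star (FreeStarAlg.gen j) - 1) = 0}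

theorem CStarSeminorm.one_le {P : Type*} [Ring P] [StarRing P] [Algebra ℂ P]
    (q : CStarSeminorm P) : q 1 ≤ 1 := by
  have h := q.star_mul_self 1
  rw [star_one, one_mul] at h
  have h0 := q.nonneg 1
  nlinarith [sq_nonneg (q 1 - 1)]

theorem cuntzSeminorms_gen_le {d : ℕ} {q : CStarSeminorm (FreeStarAlg (Fin d))}
    (hq : q ∈ cuntzSeminorms d) (i : Fin d) : q (FreeStarAlg.gen i) ≤ 1 := by
  have h1 := q.star_mul_self (FreeStarAlg.gen i)
  have h2 := hq.1 i i
  rw [if_pos rfl] at h2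
  have h3 : q (star (FreeStarAlg.gen i) * FreeStarAlg.gen i) ≤ q (star (FreeStarAlg.gen i) * FreeStarAlg.gen i - 1) + q 1 := by
    have := map_add_le_add q.toSeminorm (star (FreeStarAlg.gen i) * FreeStarAlg.gen i - 1) 1
    rwa [sub_add_cancel] at this
  have h4 := q.one_le
  have h5 := q.nonneg (FreeStarAlg.gen i)
  nlinarith

theorem cuntzSeminorms_bddAbove (d : ℕ) (x : FreeStarAlg (Fin d)) :
    BddAbove (Set.range fun q : cuntzSeminorms d => q.1 x) := by
  suffices h : ∃ M : ℝ, 0 ≤ M ∧ ∀ q : cuntzSeminorms d, q.1 x ≤ M by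
    obtain ⟨M, -, hM⟩ := h
    exact ⟨M, by rintro _ ⟨q, rfl⟩; exact hM q⟩
  induction x using FreeStarAlg.induction with
  | h0 r =>
    refine ⟨‖r‖, norm_nonneg _, fun q => ?_⟩
    rw [Algebra.algebraMap_eq_smul_one]
    refine (map_smul_eq_mul q.1.toSeminorm r 1).trans_le ?_
    exact mul_le_of_le_one_right (norm_nonneg _) q.1.one_le
  | h1 s =>
    refine ⟨1, zero_le_one, fun q => ?_⟩
    cases s with
    | inl i => exact cuntzSeminorms_gen_le q.2 i
    | inr i =>
      have : FreeStarAlg.letter (Sum.inr i) = star (FreeStarAlg.gen i) :=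
        (FreeStarAlg.star_letter (Sum.inl i)).symm
      rw [this, q.1.star_eq]
      exact cuntzSeminorms_gen_le q.2 i
  | hm a b ha hb =>
    obtain ⟨M, hM0, hM⟩ := ha
    obtain ⟨K, hK0, hK⟩ := hb
    exact ⟨M * K, mul_nonneg hM0 hK0, fun q => (q.1.mul_le a b).trans
      (mul_le_mul (hM q) (hK q) (q.1.nonneg b) hM0)⟩
  | ha a b ha hb =>
    obtain ⟨M, hM0, hM⟩ := ha
    obtain ⟨K, hK0, hK⟩ := hb
    exact ⟨M + K, add_nonneg hM0 hK0, fun q => (map_add_le_add q.1.toSeminorm a b).trans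
      (add_le_add (hM q) (hK q))⟩

/-- The largest C*-seminorm in which the Cuntz relations hold. -/
def cuntzSeminorm (d : ℕ) : CStarSeminorm (FreeStarAlg (Fin d)) :=
  CStarSeminorm.sup (cuntzSeminorms d) (cuntzSeminorms_bddAbove d)

/-- The Cuntz algebra `𝒪_d`: the universal unital C*-algebra generated by a family of `d` elements
satisfying the Cuntz relations. -/
def CuntzAlgebra (d : ℕ) : Type := CStarCompletion (cuntzSeminorm d)

namespace CuntzAlgebra

variable {d : ℕ}

instance : CStarAlgebra (CuntzAlgebra d) :=
  inferInstanceAs (CStarAlgebra (CStarCompletion (cuntzSeminorm d)))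

/-- The map from noncommutative `*`-polynomials to the Cuntz algebra. -/
def of (d : ℕ) : FreeStarAlg (Fin d) →⋆ₐ[ℂ] CuntzAlgebra d := CStarCompletion.of (cuntzSeminorm d)

/-- The canonical generators of the Cuntz algebra. -/
def S (i : Fin d) : CuntzAlgebra d := of d (FreeStarAlg.gen i)

theorem norm_of (x : FreeStarAlg (Fin d)) : ‖of d x‖ = cuntzSeminorm d x :=
  CStarCompletion.norm_of (cuntzSeminorm d) x

theorem of_eq_zero {x : FreeStarAlg (Fin d)} (h : ∀ q ∈ cuntzSeminorms d, q x = 0) :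
    of d x = 0 := by
  rw [← norm_le_zero_iff, norm_of]
  exact CStarSeminorm.sup_le _ le_rfl (fun q hq => (h q hq).le)

theorem isCuntzFamily_S : IsCuntzFamily (S : Fin d → CuntzAlgebra d) where
  star_mul i j := by
    have h : of d (star (FreeStarAlg.gen i) * FreeStarAlg.gen j - if i = j then 1 else 0) = 0 :=
      of_eq_zero fun q hq => hq.1 i j
    rw [map_sub, map_mul, map_star, sub_eq_zero] at h
    rw [S, S, h]
    split_ifs <;> simp
  sum_mul_star := by
    have h : of d (∑ j, FreeStarAlg.gen j * star (FreeStarAlg.gen j) - 1) = 0 :=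
      of_eq_zero fun q hq => hq.2
    rw [map_sub, map_sum, map_one, sub_eq_zero] at h
    rw [← h]
    simp only [S, map_mul, map_star]

variable {C : Type*} [CStarAlgebra C]

theorem lift_le {T : Fin d → C} (hT : IsCuntzFamily T) (x : FreeStarAlg (Fin d)) :
    ‖FreeStarAlg.lift T x‖ ≤ cuntzSeminorm d x := by
  refine CStarSeminorm.le_sup (cuntzSeminorms_bddAbove d)
    (q := CStarSeminorm.ofHom (FreeStarAlg.lift T)) ⟨fun i j => ?_, ?_⟩ x
  · rw [CStarSeminorm.ofHom_apply, map_sub, map_mul, map_star, FreeStarAlg.lift_gen,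
      FreeStarAlg.lift_gen, hT.star_mul]
    split_ifs <;> simp
  · rw [CStarSeminorm.ofHom_apply, map_sub, map_sum]
    simp only [map_mul, map_star, FreeStarAlg.lift_gen, map_one, hT.sum_mul_star, sub_self,
      norm_zero]

/-- The universal property of the Cuntz algebra: existence. -/
def lift (T : Fin d → C) (hT : IsCuntzFamily T) : CuntzAlgebra d →⋆ₐ[ℂ] C :=
  CStarCompletion.lift (FreeStarAlg.lift T) (lift_le hT)

@[simp] theorem lift_S (T : Fin d → C) (hT : IsCuntzFamily T) (i : Fin d) :
    lift T hT (S i) = T i :=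
  (CStarCompletion.lift_of (FreeStarAlg.lift T) (lift_le hT) _).trans (FreeStarAlg.lift_gen T i)

/-- The universal property of the Cuntz algebra: uniqueness. -/
theorem hom_ext {f g : CuntzAlgebra d →⋆ₐ[ℂ] C} (h : ∀ i, f (S i) = g (S i)) : f = g := by
  refine CStarCompletion.hom_ext (p := cuntzSeminorm d) fun x => ?_
  have : f.comp (of d) = g.comp (of d) := FreeStarAlg.hom_ext h
  exact DFunLike.congr_fun this x

theorem isCuntzFamily_smul (z : Circle) :
    IsCuntzFamily (fun i => (z : ℂ) • (S i : CuntzAlgebra d)) where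
  star_mul i j := by
    have hz : star (z : ℂ) * (z : ℂ) = 1 := by
      rw [Complex.star_def, ← Complex.normSq_eq_conj_mul_self]; simp
    rw [star_smul, smul_mul_smul_comm, hz, one_smul, isCuntzFamily_S.star_mul]
  sum_mul_star := by
    have hz : (z : ℂ) * star (z : ℂ) = 1 := by
      rw [Complex.star_def, Complex.mul_conj]; simp
    simp only [star_smul, smul_mul_smul_comm, hz, one_smul, isCuntzFamily_S.sum_mul_star]

/-- The gauge action of the circle: `γ_z(Sⱼ) = z Sⱼ`. -/
def gauge (z : Circle) : CuntzAlgebra d →⋆ₐ[ℂ] CuntzAlgebra d :=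
  lift (fun i => (z : ℂ) • S i) (isCuntzFamily_smul z)

/-- The product `S_{i₁} ⋯ S_{i_k}`. -/
def word {k : ℕ} (I : Fin k → Fin d) : CuntzAlgebra d := (List.ofFn fun r => S (I r)).prod

/-- The subspace `ℋ^l (ℋ*)^k`, spanned by the elements
`S_{i₁} ⋯ S_{i_l} (S_{j₁} ⋯ S_{j_k})*`. -/
def hSpace (d l k : ℕ) : Submodule ℂ (CuntzAlgebra d) :=
  Submodule.span ℂ (Set.range fun IJ : (Fin l → Fin d) × (Fin k → Fin d) =>
    word IJ.1 * star (word IJ.2))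

end CuntzAlgebra

/-! ### The minimal tensor product -/

section HilbertTensor

open UniformSpace

variable {H K : Type*} [NormedAddCommGroup H] [InnerProductSpace ℂ H]
  [NormedAddCommGroup K] [InnerProductSpace ℂ K]

/-- The Hilbert space tensor product: the completion of the algebraic tensor product. -/
def HilbertTensor (H K : Type*) [NormedAddCommGroup H] [InnerProductSpace ℂ H]
    [NormedAddCommGroup K] [InnerProductSpace ℂ K] : Type _ := Completion (H ⊗[ℂ] K)

instance : NormedAddCommGroup (HilbertTensor H K) :=
  inferInstanceAs (NormedAddCommGroup (Completion (H ⊗[ℂ] K)))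
instance : InnerProductSpace ℂ (HilbertTensor H K) :=
  inferInstanceAs (InnerProductSpace ℂ (Completion (H ⊗[ℂ] K)))
instance : CompleteSpace (HilbertTensor H K) :=
  inferInstanceAs (CompleteSpace (Completion (H ⊗[ℂ] K)))

/-- The inclusion of the algebraic into the Hilbert space tensor product. -/
def HilbertTensor.coe (H K : Type*) [NormedAddCommGroup H] [InnerProductSpace ℂ H]
    [NormedAddCommGroup K] [InnerProductSpace ℂ K] : H ⊗[ℂ] K →ₗᵢ[ℂ] HilbertTensor H K :=
  (Completion.toComplₗᵢ : H ⊗[ℂ] K →ₗᵢ[ℂ] Completion (H ⊗[ℂ] K))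

theorem HilbertTensor.induction {Q : HilbertTensor H K → Prop} (hQ : IsClosed {v | Q v})
    (h : ∀ v : H ⊗[ℂ] K, Q (HilbertTensor.coe H K v)) (v : HilbertTensor H K) : Q v :=
  Completion.induction_on (α := H ⊗[ℂ] K) v hQ h

/-- The elementary tensor `h ⊗ k` in the Hilbert space tensor product. -/
def hTmul (h : H) (k : K) : HilbertTensor H K := HilbertTensor.coe H K (h ⊗ₜ[ℂ] k)

theorem hilbertTensor_clm_ext {L : Type*} [NormedAddCommGroup L] [NormedSpace ℂ L]
    {f g : HilbertTensor H K →L[ℂ] L} (h : ∀ x y, f (hTmul x y) = g (hTmul x y)) : f = g := by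
  ext v
  induction v using HilbertTensor.induction with
  | hQ => exact isClosed_eq f.continuous g.continuous
  | h v =>
    induction v using TensorProduct.induction_on with
    | zero => rw [map_zero, map_zero, map_zero]
    | tmul x y => exact h x y
    | add x y hx hy => rw [map_add, map_add, map_add, hx, hy]

/-- The operator `T ⊗ R` on the Hilbert space tensor product. -/
def opTensor (T : H →L[ℂ] H) (R : K →L[ℂ] K) : HilbertTensor H K →L[ℂ] HilbertTensor H K :=
  ((TensorProduct.mapL T R).completion : Completion (H ⊗[ℂ] K) →L[ℂ] Completion (H ⊗[ℂ] K))

theorem opTensor_coe (T : H →L[ℂ] H) (R : K →L[ℂ] K) (v : H ⊗[ℂ] K) :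
    opTensor T R (HilbertTensor.coe H K v) = HilbertTensor.coe H K (TensorProduct.mapL T R v) :=
  ContinuousLinearMap.completion_apply_coe (TensorProduct.mapL T R) v

@[simp] theorem opTensor_hTmul (T : H →L[ℂ] H) (R : K →L[ℂ] K) (h : H) (k : K) :
    opTensor T R (hTmul h k) = hTmul (T h) (R k) := by
  rw [hTmul, opTensor_coe, TensorProduct.mapL_tmul, hTmul]

theorem norm_opTensor_le (T : H →L[ℂ] H) (R : K →L[ℂ] K) : ‖opTensor T R‖ ≤ ‖T‖ * ‖R‖ := by
  refine ContinuousLinearMap.opNorm_le_bound _ (by positivity) fun v => ?_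
  induction v using HilbertTensor.induction with
  | hQ => exact isClosed_le (by fun_prop) (by fun_prop)
  | h v =>
    rw [opTensor_coe, LinearIsometry.norm_map, LinearIsometry.norm_map]
    exact ((TensorProduct.mapL T R).le_opNorm v).trans
      (mul_le_mul_of_nonneg_right (TensorProduct.norm_mapL_le T R) (norm_nonneg v))

theorem opTensor_mul (T T' : H →L[ℂ] H) (R R' : K →L[ℂ] K) :
    opTensor (T * T') (R * R') = opTensor T R * opTensor T' R' :=
  hilbertTensor_clm_ext fun x y => by simp

theorem opTensor_one : opTensor (1 : H →L[ℂ] H) (1 : K →L[ℂ] K) = 1 :=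
  hilbertTensor_clm_ext fun x y => by simp

theorem hTmul_add_left (x x' : H) (y : K) : hTmul (x + x') y = hTmul x y + hTmul x' y := by
  rw [hTmul, TensorProduct.add_tmul, map_add]; rfl

theorem hTmul_add_right (x : H) (y y' : K) : hTmul x (y + y') = hTmul x y + hTmul x y' := by
  rw [hTmul, TensorProduct.tmul_add, map_add]; rfl

theorem hTmul_smul_left (c : ℂ) (x : H) (y : K) : hTmul (c • x) y = c • hTmul x y := by
  rw [hTmul, ← TensorProduct.smul_tmul', map_smul]; rfl

theorem hTmul_smul_right (c : ℂ) (x : H) (y : K) : hTmul x (c • y) = c • hTmul x y := by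
  rw [hTmul, TensorProduct.tmul_smul, map_smul]; rfl

variable [CompleteSpace H] [CompleteSpace K]

theorem inner_opTensor (T : H →L[ℂ] H) (R : K →L[ℂ] K) (v w : HilbertTensor H K) :
    inner ℂ (opTensor (star T) (star R) v) w = inner ℂ v (opTensor T R w) := by
  induction v using HilbertTensor.induction with
  | hQ => exact isClosed_eq (by fun_prop) (by fun_prop)
  | h v =>
    induction w using HilbertTensor.induction with
    | hQ => exact isClosed_eq (by fun_prop) (by fun_prop)
    | h w =>
      rw [opTensor_coe, opTensor_coe, LinearIsometry.inner_map_map, LinearIsometry.inner_map_map]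
      induction v using TensorProduct.induction_on with
      | zero => simp
      | add x y hx hy => rw [map_add, inner_add_left, inner_add_left, hx, hy]
      | tmul x y =>
        induction w using TensorProduct.induction_on with
        | zero => simp
        | add x y hx hy => rw [map_add, inner_add_right, inner_add_right, hx, hy]
        | tmul x' y' =>
          rw [TensorProduct.mapL_tmul, TensorProduct.mapL_tmul, TensorProduct.inner_tmul,
            TensorProduct.inner_tmul, ContinuousLinearMap.star_eq_adjoint,
            ContinuousLinearMap.star_eq_adjoint, ContinuousLinearMap.adjoint_inner_left,
            ContinuousLinearMap.adjoint_inner_left]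

theorem star_opTensor (T : H →L[ℂ] H) (R : K →L[ℂ] K) :
    star (opTensor T R) = opTensor (star T) (star R) := by
  rw [ContinuousLinearMap.star_eq_adjoint]
  exact ((ContinuousLinearMap.eq_adjoint_iff _ _).2 (inner_opTensor T R)).symm

/-- `T ↦ T ⊗ 1`. -/
def opLeft (H K : Type*) [NormedAddCommGroup H] [InnerProductSpace ℂ H] [CompleteSpace H]
    [NormedAddCommGroup K] [InnerProductSpace ℂ K] [CompleteSpace K] :
    (H →L[ℂ] H) →ₐ[ℂ] (HilbertTensor H K →L[ℂ] HilbertTensor H K) :=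
  AlgHom.ofLinearMap
    { toFun := fun T => opTensor T 1
      map_add' := fun T T' => hilbertTensor_clm_ext fun x y => by simp [hTmul_add_left]
      map_smul' := fun c T => hilbertTensor_clm_ext fun x y => by simp [hTmul_smul_left] }
    opTensor_one (fun T T' => by
      change opTensor _ _ = opTensor _ _ * opTensor _ _
      rw [← opTensor_mul, one_mul])

/-- `R ↦ 1 ⊗ R`. -/
def opRight (H K : Type*) [NormedAddCommGroup H] [InnerProductSpace ℂ H] [CompleteSpace H]
    [NormedAddCommGroup K] [InnerProductSpace ℂ K] [CompleteSpace K] :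
    (K →L[ℂ] K) →ₐ[ℂ] (HilbertTensor H K →L[ℂ] HilbertTensor H K) :=
  AlgHom.ofLinearMap
    { toFun := fun R => opTensor 1 R
      map_add' := fun T T' => hilbertTensor_clm_ext fun x y => by simp [hTmul_add_right]
      map_smul' := fun c T => hilbertTensor_clm_ext fun x y => by simp [hTmul_smul_right] }
    opTensor_one (fun T T' => by
      change opTensor _ _ = opTensor _ _ * opTensor _ _
      rw [← opTensor_mul, one_mul])

theorem opLeft_mul_opRight (T : H →L[ℂ] H) (R : K →L[ℂ] K) :
    opLeft H K T * opRight H K R = opTensor T R := by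
  change opTensor _ _ * opTensor _ _ = _
  rw [← opTensor_mul, one_mul, mul_one]

theorem opRight_mul_opLeft (T : H →L[ℂ] H) (R : K →L[ℂ] K) :
    opRight H K R * opLeft H K T = opTensor T R := by
  change opTensor _ _ * opTensor _ _ = _
  rw [← opTensor_mul, one_mul, mul_one]

end HilbertTensor

section MinTensor

universe u v

variable {A : Type u} {B : Type v} [CStarAlgebra A] [CStarAlgebra B]

instance : StarModule ℂ (A ⊗[ℂ] B) where
  star_smul c x := by
    induction x using TensorProduct.induction_on with
    | zero => simp
    | tmul a b => rw [TensorProduct.smul_tmul', TensorProduct.star_tmul, TensorProduct.star_tmul,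
        star_smul, TensorProduct.smul_tmul']
    | add x y hx hy => rw [smul_add, star_add, hx, hy, star_add, smul_add]

variable {H : Type u} {K : Type v} [NormedAddCommGroup H] [InnerProductSpace ℂ H] [CompleteSpace H]
  [NormedAddCommGroup K] [InnerProductSpace ℂ K] [CompleteSpace K]

/-- The product representation `a ⊗ b ↦ π(a) ⊗ σ(b)` as an algebra homomorphism. -/
def algProdRep (π : A →⋆ₐ[ℂ] (H →L[ℂ] H)) (σ : B →⋆ₐ[ℂ] (K →L[ℂ] K)) :
    A ⊗[ℂ] B →ₐ[ℂ] (HilbertTensor H K →L[ℂ] HilbertTensor H K) :=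
  Algebra.TensorProduct.lift ((opLeft H K).comp π.toAlgHom) ((opRight H K).comp σ.toAlgHom)
    (fun a b => (opLeft_mul_opRight (π a) (σ b)).trans (opRight_mul_opLeft (π a) (σ b)).symm)

theorem algProdRep_tmul (π : A →⋆ₐ[ℂ] (H →L[ℂ] H)) (σ : B →⋆ₐ[ℂ] (K →L[ℂ] K)) (a : A) (b : B) :
    algProdRep π σ (a ⊗ₜ b) = opTensor (π a) (σ b) :=
  (Algebra.TensorProduct.lift_tmul _ _ _ a b).trans (opLeft_mul_opRight (π a) (σ b))

/-- The product representation `π ⊗ σ` of the algebraic tensor product. -/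
def prodRep₀ (π : A →⋆ₐ[ℂ] (H →L[ℂ] H)) (σ : B →⋆ₐ[ℂ] (K →L[ℂ] K)) :
    A ⊗[ℂ] B →⋆ₐ[ℂ] (HilbertTensor H K →L[ℂ] HilbertTensor H K) where
  __ := algProdRep π σ
  map_star' x := by
    change algProdRep π σ (star x) = star (algProdRep π σ x)
    induction x using TensorProduct.induction_on with
    | zero => rw [star_zero, map_zero]; exact (star_zero _).symm
    | tmul a b =>
      rw [TensorProduct.star_tmul, algProdRep_tmul, algProdRep_tmul, star_opTensor, map_star,
        map_star]
    | add x y hx hy => rw [star_add, map_add, hx, hy, map_add, star_add]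

theorem prodRep₀_tmul (π : A →⋆ₐ[ℂ] (H →L[ℂ] H)) (σ : B →⋆ₐ[ℂ] (K →L[ℂ] K)) (a : A) (b : B) :
    prodRep₀ π σ (a ⊗ₜ b) = opTensor (π a) (σ b) := algProdRep_tmul π σ a b

variable (A B) in
/-- The C*-seminorms `x ↦ ‖(π ⊗ σ)(x)‖` given by representations `π` of `A` and `σ` of `B`. -/
def spatialSeminorms : Set (CStarSeminorm (A ⊗[ℂ] B)) :=
  {q | ∃ (H : Type u) (_ : NormedAddCommGroup H) (_ : InnerProductSpace ℂ H) (_ : CompleteSpace H)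
    (K : Type v) (_ : NormedAddCommGroup K) (_ : InnerProductSpace ℂ K) (_ : CompleteSpace K)
    (π : A →⋆ₐ[ℂ] (H →L[ℂ] H)) (σ : B →⋆ₐ[ℂ] (K →L[ℂ] K)),
    q = CStarSeminorm.ofHom (prodRep₀ π σ)}

theorem spatialSeminorms_tmul_le {q : CStarSeminorm (A ⊗[ℂ] B)} (hq : q ∈ spatialSeminorms A B)
    (a : A) (b : B) : q (a ⊗ₜ b) ≤ ‖a‖ * ‖b‖ := by
  obtain ⟨H, _, _, _, K, _, _, _, π, σ, rfl⟩ := hq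
  rw [CStarSeminorm.ofHom_apply, prodRep₀_tmul]
  exact (norm_opTensor_le _ _).trans (mul_le_mul (NonUnitalStarAlgHom.norm_apply_le π a)
    (NonUnitalStarAlgHom.norm_apply_le σ b) (norm_nonneg _) (norm_nonneg _))

theorem spatialSeminorms_bddAbove (x : A ⊗[ℂ] B) :
    BddAbove (Set.range fun q : spatialSeminorms A B => q.1 x) := by
  suffices h : ∃ M : ℝ, ∀ q : spatialSeminorms A B, q.1 x ≤ M by
    obtain ⟨M, hM⟩ := h
    exact ⟨M, by rintro _ ⟨q, rfl⟩; exact hM q⟩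
  induction x using TensorProduct.induction_on with
  | zero => exact ⟨0, fun q => (map_zero q.1.toSeminorm).le⟩
  | tmul a b => exact ⟨‖a‖ * ‖b‖, fun q => spatialSeminorms_tmul_le q.2 a b⟩
  | add x y hx hy =>
    obtain ⟨M, hM⟩ := hx
    obtain ⟨L, hL⟩ := hy
    exact ⟨M + L, fun q => (map_add_le_add q.1.toSeminorm x y).trans (add_le_add (hM q) (hL q))⟩

variable (A B) in
/-- The minimal (spatial) C*-norm on the algebraic tensor product:
`‖x‖ = sup ‖(π ⊗ σ)(x)‖` over all representations `π` of `A` and `σ` of `B`. -/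
def spatialSeminorm : CStarSeminorm (A ⊗[ℂ] B) :=
  CStarSeminorm.sup (spatialSeminorms A B) spatialSeminorms_bddAbove

variable (A B) in
/-- The minimal tensor product of two unital C*-algebras. -/
def MinTensor : Type max u v := CStarCompletion (spatialSeminorm A B)

namespace MinTensor

instance : CStarAlgebra (MinTensor A B) :=
  inferInstanceAs (CStarAlgebra (CStarCompletion (spatialSeminorm A B)))

variable (A B) in
/-- The canonical map of the algebraic into the minimal tensor product. -/
def of : A ⊗[ℂ] B →⋆ₐ[ℂ] MinTensor A B := CStarCompletion.of (spatialSeminorm A B)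

/-- The elementary tensor `a ⊗ b` in the minimal tensor product. -/
def tmul (a : A) (b : B) : MinTensor A B := of A B (a ⊗ₜ[ℂ] b)

theorem tmul_mul_tmul (a a' : A) (b b' : B) :
    tmul a b * tmul a' b' = tmul (a * a') (b * b') := by
  rw [tmul, tmul, ← map_mul, Algebra.TensorProduct.tmul_mul_tmul, tmul]

theorem star_tmul (a : A) (b : B) : star (tmul a b) = tmul (star a) (star b) := by
  rw [tmul, ← map_star, TensorProduct.star_tmul, tmul]

theorem one_tmul_one : tmul (1 : A) (1 : B) = 1 := by
  rw [tmul, ← Algebra.TensorProduct.one_def, map_one]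

variable (B) in
/-- The `*`-homomorphism `a ↦ a ⊗ 1`. -/
def inclLeft : A →⋆ₐ[ℂ] MinTensor A B where
  toFun a := tmul a 1
  map_one' := one_tmul_one
  map_mul' a a' := by rw [tmul_mul_tmul, one_mul]
  map_zero' := by rw [tmul, TensorProduct.zero_tmul, map_zero]
  map_add' a a' := by rw [tmul, TensorProduct.add_tmul, map_add]; rfl
  commutes' c := by
    rw [tmul, ← Algebra.TensorProduct.algebraMap_apply]
    exact AlgHomClass.commutes (of A B) c
  map_star' a := by rw [star_tmul, star_one]

/-- The product representation `π ⊗ σ` of the minimal tensor product. -/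
def prodRep (π : A →⋆ₐ[ℂ] (H →L[ℂ] H)) (σ : B →⋆ₐ[ℂ] (K →L[ℂ] K)) :
    MinTensor A B →⋆ₐ[ℂ] (HilbertTensor H K →L[ℂ] HilbertTensor H K) :=
  CStarCompletion.lift (prodRep₀ π σ) fun x =>
    CStarSeminorm.le_sup spatialSeminorms_bddAbove
      (q := CStarSeminorm.ofHom (prodRep₀ π σ)) ⟨H, _, _, _, K, _, _, _, π, σ, rfl⟩ x

theorem prodRep_tmul (π : A →⋆ₐ[ℂ] (H →L[ℂ] H)) (σ : B →⋆ₐ[ℂ] (K →L[ℂ] K)) (a : A) (b : B) :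
    prodRep π σ (tmul a b) = opTensor (π a) (σ b) :=
  (CStarCompletion.lift_of (prodRep₀ π σ) _ (a ⊗ₜ[ℂ] b)).trans (prodRep₀_tmul π σ a b)

end MinTensor

end MinTensor

/-! ### Compact quantum groups and their representations -/

universe u w

/-- Coassociativity `(Δ ⊗ id) Δ = (id ⊗ Δ) Δ` of a `*`-homomorphism `Δ : A → A ⊗ A`. The two sides
are compared in every product representation `π₁ ⊗ π₂ ⊗ π₃` of `A ⊗ A ⊗ A` (these define the norm of
the minimal tensor product), through their matrix coefficients at elementary tensors. -/
def Coassociative {A : Type u} [CStarAlgebra A] (Δ : A →⋆ₐ[ℂ] MinTensor A A) : Prop :=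
  ∀ (H₁ H₂ H₃ : Type u)
    [NormedAddCommGroup H₁] [InnerProductSpace ℂ H₁] [CompleteSpace H₁]
    [NormedAddCommGroup H₂] [InnerProductSpace ℂ H₂] [CompleteSpace H₂]
    [NormedAddCommGroup H₃] [InnerProductSpace ℂ H₃] [CompleteSpace H₃]
    (π₁ : A →⋆ₐ[ℂ] (H₁ →L[ℂ] H₁)) (π₂ : A →⋆ₐ[ℂ] (H₂ →L[ℂ] H₂)) (π₃ : A →⋆ₐ[ℂ] (H₃ →L[ℂ] H₃))
    (a : A) (x₁ y₁ : H₁) (x₂ y₂ : H₂) (x₃ y₃ : H₃),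
    inner ℂ (hTmul (hTmul x₁ x₂) x₃)
        (MinTensor.prodRep ((MinTensor.prodRep π₁ π₂).comp Δ) π₃ (Δ a)
          (hTmul (hTmul y₁ y₂) y₃)) =
      inner ℂ (hTmul x₁ (hTmul x₂ x₃))
        (MinTensor.prodRep π₁ ((MinTensor.prodRep π₂ π₃).comp Δ) (Δ a)
          (hTmul y₁ (hTmul y₂ y₃)))

/-- A compact quantum group `𝔾` with `C(𝔾) = A`. -/
structure CompactQuantumGroup (A : Type u) [CStarAlgebra A] where
  nontrivial : Nontrivial A
  separable : TopologicalSpace.SeparableSpace A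
  /-- The comultiplication. -/
  comul : A →⋆ₐ[ℂ] MinTensor A A
  coassoc : Coassociative comul
  cancel_left : Dense (Submodule.span ℂ
    (Set.range fun ab : A × A => comul ab.1 * MinTensor.tmul ab.2 1) : Set (MinTensor A A))
  cancel_right : Dense (Submodule.span ℂ
    (Set.range fun ab : A × A => comul ab.1 * MinTensor.tmul 1 ab.2) : Set (MinTensor A A))

/-- A unitary representation of `𝔾` on `ℂ^d`: a unitary matrix `(αᵢⱼ)` over `C(𝔾)` such that
`Δ(αᵢⱼ) = ∑ₖ αᵢₖ ⊗ αₖⱼ`. -/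
structure UnitaryRep {A : Type u} [CStarAlgebra A] (G : CompactQuantumGroup A) (d : ℕ) where
  /-- The matrix of the representation. -/
  mat : Matrix (Fin d) (Fin d) A
  comul_mat : ∀ i j, G.comul (mat i j) = ∑ k, MinTensor.tmul (mat i k) (mat k j)
  sum_star_mul : ∀ i j, ∑ k, star (mat k i) * mat k j = if i = j then 1 else 0
  sum_mul_star : ∀ i j, ∑ k, mat i k * star (mat j k) = if i = j then 1 else 0

namespace UnitaryRep

variable {A : Type u} [CStarAlgebra A] {G : CompactQuantumGroup A} {d : ℕ}

/-- The matrix of the `k`-fold tensor power `α^k`, acting on `(ℂ^d)^{⊗k}` with its basis indexed by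
`Fin k → Fin d`: its `(I, J)` entry is `α_{i₁ j₁} ⋯ α_{i_k j_k}`. -/
def tensorPow (α : UnitaryRep G d) (k : ℕ) : Matrix (Fin k → Fin d) (Fin k → Fin d) A :=
  fun I J => (List.ofFn fun r => α.mat (I r) (J r)).prod

/-- The linear map with matrix `T` intertwines the representations with matrices `β` and `β'`:
`(T ⊗ 1) δ_β = δ_β' T`, where `δ_β(e_j) = ∑ᵢ eᵢ ⊗ βᵢⱼ`. -/
def Intertwines {m n : Type*} [Fintype m] [Fintype n] (T : Matrix n m ℂ) (β : Matrix m m A)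
    (β' : Matrix n n A) : Prop :=
  T.map (algebraMap ℂ A) * β = β' * T.map (algebraMap ℂ A)

/-- The representation with matrix `β` is contained in the one with matrix `β'`: there is an
injective intertwiner. -/
def IsContainedIn {m n : Type*} [Fintype m] [Fintype n] (β : Matrix m m A) (β' : Matrix n n A) :
    Prop :=
  ∃ T : Matrix n m ℂ, Intertwines T β β' ∧ Function.Injective T.mulVec

open CuntzAlgebra

theorem isCuntzFamily_coaction (α : UnitaryRep G d) :
    IsCuntzFamily (fun i => ∑ j, MinTensor.tmul (S j : CuntzAlgebra d) (α.mat j i)) where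
  star_mul i j := by
    have h : ∀ k : Fin d, star (MinTensor.tmul (S k : CuntzAlgebra d) (α.mat k i)) *
        ∑ l, MinTensor.tmul (S l : CuntzAlgebra d) (α.mat l j) =
        MinTensor.tmul 1 (star (α.mat k i) * α.mat k j) := by
      intro k
      rw [Finset.mul_sum, Finset.sum_eq_single k]
      · rw [MinTensor.star_tmul, MinTensor.tmul_mul_tmul, isCuntzFamily_S.star_mul, if_pos rfl]
      · intro l _ hl
        rw [MinTensor.star_tmul, MinTensor.tmul_mul_tmul, isCuntzFamily_S.star_mul,
          if_neg (Ne.symm hl), MinTensor.tmul, TensorProduct.zero_tmul, map_zero]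
      · intro hk; exact absurd (Finset.mem_univ k) hk
    rw [star_sum, Finset.sum_mul, Finset.sum_congr rfl fun k _ => h k]
    simp only [MinTensor.tmul]
    rw [← map_sum, ← TensorProduct.tmul_sum, α.sum_star_mul]
    split_ifs
    · exact MinTensor.one_tmul_one
    · rw [TensorProduct.tmul_zero, map_zero]
  sum_mul_star := by
    have h : ∀ k l : Fin d, ∑ j, MinTensor.tmul (S k : CuntzAlgebra d) (α.mat k j) *
        star (MinTensor.tmul (S l : CuntzAlgebra d) (α.mat l j)) =
        if k = l then MinTensor.tmul (S k * star (S k)) 1 else 0 := by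
      intro k l
      simp only [MinTensor.star_tmul, MinTensor.tmul_mul_tmul]
      simp only [MinTensor.tmul]
      rw [← map_sum, ← TensorProduct.tmul_sum, α.sum_mul_star]
      split_ifs with hkl
      · rw [hkl]
      · rw [TensorProduct.tmul_zero, map_zero]
    have h2 : ∀ j : Fin d, (∑ k, MinTensor.tmul (S k : CuntzAlgebra d) (α.mat k j)) *
        star (∑ l, MinTensor.tmul (S l : CuntzAlgebra d) (α.mat l j)) =
        ∑ k, ∑ l, MinTensor.tmul (S k : CuntzAlgebra d) (α.mat k j) *
          star (MinTensor.tmul (S l : CuntzAlgebra d) (α.mat l j)) := by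
      intro j
      rw [star_sum, Finset.sum_mul_sum]
    rw [Finset.sum_congr rfl fun j _ => h2 j, Finset.sum_comm]
    have h3 : ∀ k : Fin d, ∑ j, ∑ l, MinTensor.tmul (S k : CuntzAlgebra d) (α.mat k j) *
        star (MinTensor.tmul (S l : CuntzAlgebra d) (α.mat l j)) =
        MinTensor.tmul (S k * star (S k)) (1 : A) := by
      intro k
      rw [Finset.sum_comm, Finset.sum_congr rfl fun l _ => h k l, Finset.sum_ite_eq,
        if_pos (Finset.mem_univ k)]
    rw [Finset.sum_congr rfl fun k _ => h3 k]
    simp only [MinTensor.tmul]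
    rw [← map_sum, ← TensorProduct.sum_tmul, isCuntzFamily_S.sum_mul_star]
    exact MinTensor.one_tmul_one

/-- The action `δ : 𝒪_d → 𝒪_d ⊗ C(𝔾)` with `δ(Sᵢ) = ∑ⱼ Sⱼ ⊗ αⱼᵢ`. -/
def coaction (α : UnitaryRep G d) : CuntzAlgebra d →⋆ₐ[ℂ] MinTensor (CuntzAlgebra d) A :=
  CuntzAlgebra.lift _ α.isCuntzFamily_coaction

/-- The fixed point algebra `𝒪_d^α = {T | δ(T) = T ⊗ 1}`. -/
def fixedAlg (α : UnitaryRep G d) : StarSubalgebra ℂ (CuntzAlgebra d) :=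
  StarAlgHom.equalizer α.coaction (MinTensor.inclLeft A)

theorem mem_fixedAlg (α : UnitaryRep G d) (T : CuntzAlgebra d) :
    T ∈ α.fixedAlg ↔ α.coaction T = MinTensor.tmul T 1 := Iff.rfl

/-- The gauge-invariant part `ℱ^α = {T ∈ 𝒪_d^α | γ_z(T) = T for all z ∈ S¹}`. -/
def gaugeFixedAlg (α : UnitaryRep G d) : StarSubalgebra ℂ (CuntzAlgebra d) :=
  α.fixedAlg ⊓ ⨅ z : Circle, StarAlgHom.equalizer (gauge z) (StarAlgHom.id ℂ (CuntzAlgebra d))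

theorem mem_gaugeFixedAlg (α : UnitaryRep G d) (T : CuntzAlgebra d) :
    T ∈ α.gaugeFixedAlg ↔ T ∈ α.fixedAlg ∧ ∀ z : Circle, gauge z T = T := by
  rw [gaugeFixedAlg, StarSubalgebra.mem_inf, StarSubalgebra.mem_iInf]; rfl

instance isClosed_fixedAlg (α : UnitaryRep G d) : IsClosed (α.fixedAlg : Set (CuntzAlgebra d)) :=
  isClosed_eq (starAlgHom_continuous α.coaction) (starAlgHom_continuous (MinTensor.inclLeft A))

instance isClosed_gaugeFixedAlg (α : UnitaryRep G d) :
    IsClosed (α.gaugeFixedAlg : Set (CuntzAlgebra d)) := by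
  have : (α.gaugeFixedAlg : Set (CuntzAlgebra d)) =
      (α.fixedAlg : Set (CuntzAlgebra d)) ∩ ⋂ z : Circle, {T | gauge z T = T} := by
    ext T
    rw [Set.mem_inter_iff, Set.mem_iInter]
    exact mem_gaugeFixedAlg α T
  rw [this]
  exact (isClosed_fixedAlg α).inter (isClosed_iInter fun z =>
    isClosed_eq (starAlgHom_continuous (gauge z)) continuous_id)

end UnitaryRep

/-! ### C*-correspondences and Cuntz-Pimsner algebras -/

/-- A C*-correspondence structure over the unital C*-algebra `A` on the Banach space `E`: a right
Hilbert `A`-module with a unital left action of `A` by adjointable operators (`φ` is a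
`*`-homomorphism). -/
structure CStarCorrespondence (A E : Type*) [CStarAlgebra A] [NormedAddCommGroup E]
    [NormedSpace ℂ E] where
  complete : CompleteSpace E
  /-- The right action `rsmul ξ a = ξ a`. -/
  rsmul : E →ₗ[ℂ] A →ₗ[ℂ] E
  rsmul_mul : ∀ ξ a b, rsmul ξ (a * b) = rsmul (rsmul ξ a) b
  rsmul_one : ∀ ξ, rsmul ξ 1 = ξ
  /-- The `A`-valued inner product, linear in the second variable. -/
  inner : E → E → A
  inner_add_right : ∀ ξ η ζ, inner ξ (η + ζ) = inner ξ η + inner ξ ζ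
  inner_smul_right : ∀ (c : ℂ) ξ η, inner ξ (c • η) = c • inner ξ η
  inner_rsmul_right : ∀ ξ η a, inner ξ (rsmul η a) = inner ξ η * a
  star_inner : ∀ ξ η, star (inner ξ η) = inner η ξ
  inner_self_nonneg : ∀ ξ, ∃ b, inner ξ ξ = star b * b
  norm_sq : ∀ ξ, ‖ξ‖ ^ 2 = ‖inner ξ ξ‖
  /-- The left action `φ a ξ = a ξ`. -/
  φ : A →ₐ[ℂ] Module.End ℂ E
  inner_φ_left : ∀ a ξ η, inner (φ a ξ) η = inner ξ (φ (star a) η)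

namespace CStarCorrespondence

variable {A E : Type*} [CStarAlgebra A] [NormedAddCommGroup E] [NormedSpace ℂ E]

/-- A finite frame: `∑ᵢ ξᵢ ⟨ξᵢ, ξ⟩ = ξ` for all `ξ`. -/
def IsFrame (X : CStarCorrespondence A E) {ι : Type*} [Fintype ι] (f : ι → E) : Prop :=
  ∀ ξ, ∑ i, X.rsmul (f i) (X.inner (f i) ξ) = ξ

/-- A compatible representation `(π, t)` on a C*-algebra `B` of the C*-correspondence `E` with the
frame `f`. -/
structure CompatibleRep (X : CStarCorrespondence A E) {ι : Type*} [Fintype ι] (f : ι → E)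
    (B : Type*) [NonUnitalCStarAlgebra B] where
  /-- The representation of the coefficient algebra. -/
  π : A →⋆ₙₐ[ℂ] B
  /-- The representation of the module. -/
  t : E →ₗ[ℂ] B
  star_t_mul_t : ∀ ξ η, star (t ξ) * t η = π (X.inner ξ η)
  π_mul_t : ∀ a ξ, π a * t ξ = t (X.φ a ξ)
  sum_frame : ∑ i, t (f i) * star (t (f i)) = π 1

/-- The C*-algebra `P` with the compatible representation `r` is the Cuntz-Pimsner algebra `𝒪_E` of
the C*-correspondence `E` (with the frame `f`): every compatible representation of `E` on a
C*-algebra factors through `r` by a unique `*`-homomorphism. -/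
def IsCuntzPimsner (X : CStarCorrespondence A E) {ι : Type*} [Fintype ι] (f : ι → E)
    {P : Type*} [NonUnitalCStarAlgebra P] (r : X.CompatibleRep f P) : Prop :=
  ∀ (B : Type w) [NonUnitalCStarAlgebra B] (s : X.CompatibleRep f B),
    ∃! Φ : P →⋆ₙₐ[ℂ] B, (∀ a, Φ (r.π a) = s.π a) ∧ ∀ ξ, Φ (r.t ξ) = s.t ξ

end CStarCorrespondence

/-! ### The correspondence `ν* ℱ^α` -/

namespace UnitaryRep

open CuntzAlgebra

variable {A : Type u} [CStarAlgebra A] {G : CompactQuantumGroup A} {d : ℕ}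

/-- `ν` is an isometry in `ℋ^{N+1} (ℋ*)^N ∩ 𝒪_d^α`. -/
structure IsShiftIsometry (α : UnitaryRep G d) (N : ℕ) (ν : CuntzAlgebra d) : Prop where
  star_mul_self : star ν * ν = 1
  mem_hSpace : ν ∈ hSpace d (N + 1) N
  mem_fixedAlg : ν ∈ α.fixedAlg

theorem gauge_S (z : Circle) (i : Fin d) : gauge z (S i) = (z : ℂ) • S i := lift_S _ _ i

theorem gauge_word (z : Circle) {k : ℕ} (I : Fin k → Fin d) :
    gauge z (word I) = (z : ℂ) ^ k • word I := by
  induction k with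
  | zero => simp [word]
  | succ k ih =>
    have h : word I = S (I 0) * word (fun r => I r.succ) := by
      simp [word, List.ofFn_succ]
    rw [h, map_mul, gauge_S, ih, smul_mul_smul_comm, pow_succ']

theorem gauge_of_mem_hSpace (z : Circle) {N : ℕ} {x : CuntzAlgebra d}
    (hx : x ∈ hSpace d (N + 1) N) : gauge z x = (z : ℂ) • x := by
  have hz : (z : ℂ) * star (z : ℂ) = 1 := by
    rw [Complex.star_def, Complex.mul_conj]; simp
  induction hx using Submodule.span_induction with
  | mem x hx =>
    obtain ⟨⟨I, J⟩, rfl⟩ := hx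
    simp only [map_mul, map_star, gauge_word, star_smul, star_pow, smul_mul_smul_comm]
    rw [pow_succ', mul_assoc, ← mul_pow, hz, one_pow, mul_one]
  | zero => simp
  | add x y _ _ hx hy => rw [map_add, hx, hy, smul_add]
  | smul c x _ hx => rw [map_smul, hx, smul_comm]

variable (α : UnitaryRep G d)

/-- The subspace `E = ν* ℱ^α` of `𝒪_d`. -/
def corrSpace (ν : CuntzAlgebra d) : Submodule ℂ (CuntzAlgebra d) :=
  α.gaugeFixedAlg.toSubalgebra.toSubmodule.map (LinearMap.mulLeft ℂ (star ν))

variable {α} {N : ℕ} {ν : CuntzAlgebra d}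

theorem mem_corrSpace {x : CuntzAlgebra d} :
    x ∈ α.corrSpace ν ↔ ∃ a ∈ α.gaugeFixedAlg, star ν * a = x := Iff.rfl

namespace IsShiftIsometry

theorem gauge_eq (hν : α.IsShiftIsometry N ν) (z : Circle) : gauge z ν = (z : ℂ) • ν :=
  gauge_of_mem_hSpace z hν.mem_hSpace

theorem mem_corrSpace_iff (hν : α.IsShiftIsometry N ν) {x : CuntzAlgebra d} :
    x ∈ α.corrSpace ν ↔ x ∈ α.fixedAlg ∧ ∀ z : Circle, gauge z x = star (z : ℂ) • x := by
  constructor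
  · rintro ⟨a, ha, rfl⟩
    have ha' := (α.mem_gaugeFixedAlg a).1 ha
    refine ⟨mul_mem (star_mem hν.mem_fixedAlg) ha'.1, fun z => ?_⟩
    change gauge z (star ν * a) = star (z : ℂ) • (star ν * a)
    rw [map_mul, map_star, hν.gauge_eq, ha'.2, star_smul, smul_mul_assoc]
  · rintro ⟨hx, hz⟩
    refine mem_corrSpace.2 ⟨ν * x, (α.mem_gaugeFixedAlg _).2
      ⟨mul_mem hν.mem_fixedAlg hx, fun z => ?_⟩, ?_⟩
    · have h1 : (z : ℂ) * star (z : ℂ) = 1 := by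
        rw [Complex.star_def, Complex.mul_conj]; simp
      rw [map_mul, hν.gauge_eq, hz, smul_mul_smul_comm, h1, one_smul]
    · rw [← mul_assoc, hν.star_mul_self, one_mul]

theorem isometry_mul_mem (hν : α.IsShiftIsometry N ν) {x : CuntzAlgebra d}
    (hx : x ∈ α.corrSpace ν) : ν * x ∈ α.gaugeFixedAlg := by
  rw [hν.mem_corrSpace_iff] at hx
  refine (α.mem_gaugeFixedAlg _).2 ⟨mul_mem hν.mem_fixedAlg hx.1, fun z => ?_⟩
  have h1 : (z : ℂ) * star (z : ℂ) = 1 := by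
    rw [Complex.star_def, Complex.mul_conj]; simp
  rw [map_mul, hν.gauge_eq, hx.2, smul_mul_smul_comm, h1, one_smul]

theorem star_mul_mem (hν : α.IsShiftIsometry N ν) {x y : CuntzAlgebra d}
    (hx : x ∈ α.corrSpace ν) (hy : y ∈ α.corrSpace ν) : star x * y ∈ α.gaugeFixedAlg := by
  rw [hν.mem_corrSpace_iff] at hx hy
  refine (α.mem_gaugeFixedAlg _).2 ⟨mul_mem (star_mem hx.1) hy.1, fun z => ?_⟩
  have h1 : (z : ℂ) * star (z : ℂ) = 1 := by
    rw [Complex.star_def, Complex.mul_conj]; simp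
  rw [map_mul, map_star, hx.2, hy.2, star_smul, star_star, smul_mul_smul_comm, h1, one_smul]

theorem mul_mem_right (_hν : α.IsShiftIsometry N ν) {x a : CuntzAlgebra d}
    (hx : x ∈ α.corrSpace ν) (ha : a ∈ α.gaugeFixedAlg) : x * a ∈ α.corrSpace ν := by
  obtain ⟨b, hb, rfl⟩ := mem_corrSpace.1 hx
  exact mem_corrSpace.2 ⟨b * a, mul_mem hb ha, (mul_assoc _ _ _).symm⟩

theorem mul_mem_left (hν : α.IsShiftIsometry N ν) {a x : CuntzAlgebra d}
    (ha : a ∈ α.gaugeFixedAlg) (hx : x ∈ α.corrSpace ν) : a * x ∈ α.corrSpace ν := by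
  rw [hν.mem_corrSpace_iff] at hx ⊢
  have ha' := (α.mem_gaugeFixedAlg a).1 ha
  exact ⟨mul_mem ha'.1 hx.1, fun z => by rw [map_mul, ha'.2, hx.2, mul_smul_comm]⟩

theorem isClosed_corrSpace (hν : α.IsShiftIsometry N ν) :
    IsClosed (α.corrSpace ν : Set (CuntzAlgebra d)) := by
  have : (α.corrSpace ν : Set (CuntzAlgebra d)) =
      (α.fixedAlg : Set (CuntzAlgebra d)) ∩ ⋂ z : Circle, {T | gauge z T = star (z : ℂ) • T} := by
    ext T
    rw [Set.mem_inter_iff, Set.mem_iInter]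
    exact hν.mem_corrSpace_iff
  rw [this]
  exact (isClosed_fixedAlg α).inter (isClosed_iInter fun z =>
    isClosed_eq (starAlgHom_continuous (gauge z)) (continuous_const_smul _))

theorem star_mem_corrSpace (_hν : α.IsShiftIsometry N ν) : star ν ∈ α.corrSpace ν :=
  mem_corrSpace.2 ⟨1, one_mem _, mul_one _⟩

theorem corrSpace_le (hν : α.IsShiftIsometry N ν) {x : CuntzAlgebra d} (hx : x ∈ α.corrSpace ν) :
    x ∈ α.fixedAlg := (hν.mem_corrSpace_iff.1 hx).1

/-- The natural C*-correspondence structure of `E = ν* ℱ^α` over `ℱ^α`: both actions are given by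
the multiplication of `𝒪_d`, and `⟨ξ, η⟩ = ξ* η`. -/
def correspondence (hν : α.IsShiftIsometry N ν) :
    CStarCorrespondence α.gaugeFixedAlg (α.corrSpace ν) where
  complete := hν.isClosed_corrSpace.completeSpace_coe
  rsmul := LinearMap.mk₂ ℂ (fun ξ a => ⟨ξ.1 * a.1, hν.mul_mem_right ξ.2 a.2⟩)
    (fun _ _ _ => Subtype.ext (add_mul _ _ _)) (fun _ _ _ => Subtype.ext (smul_mul_assoc _ _ _))
    (fun _ _ _ => Subtype.ext (mul_add _ _ _)) (fun _ _ _ => Subtype.ext (mul_smul_comm _ _ _))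
  rsmul_mul _ _ _ := Subtype.ext (mul_assoc _ _ _).symm
  rsmul_one _ := Subtype.ext (mul_one _)
  inner ξ η := ⟨star ξ.1 * η.1, hν.star_mul_mem ξ.2 η.2⟩
  inner_add_right _ _ _ := Subtype.ext (mul_add _ _ _)
  inner_smul_right _ _ _ := Subtype.ext (mul_smul_comm _ _ _)
  inner_rsmul_right _ _ _ := Subtype.ext (mul_assoc _ _ _).symm
  star_inner ξ η := Subtype.ext (by
    change star (star ξ.1 * η.1) = star η.1 * ξ.1
    rw [star_mul, star_star])
  inner_self_nonneg ξ := by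
    refine ⟨⟨ν * ξ.1, hν.isometry_mul_mem ξ.2⟩, Subtype.ext ?_⟩
    change star ξ.1 * ξ.1 = star (ν * ξ.1) * (ν * ξ.1)
    rw [star_mul, mul_assoc, ← mul_assoc (star ν), hν.star_mul_self, one_mul]
  norm_sq ξ := by
    change ‖ξ.1‖ ^ 2 = ‖star ξ.1 * ξ.1‖
    rw [CStarRing.norm_star_mul_self, sq]
  φ := AlgHom.ofLinearMap
    (LinearMap.mk₂ ℂ (fun a ξ => ⟨a.1 * ξ.1, hν.mul_mem_left a.2 ξ.2⟩)
      (fun _ _ _ => Subtype.ext (add_mul _ _ _)) (fun _ _ _ => Subtype.ext (smul_mul_assoc _ _ _))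
      (fun _ _ _ => Subtype.ext (mul_add _ _ _)) (fun _ _ _ => Subtype.ext (mul_smul_comm _ _ _)))
    (LinearMap.ext fun _ => Subtype.ext (one_mul _))
    (fun _ _ => LinearMap.ext fun _ => Subtype.ext (mul_assoc _ _ _))
  inner_φ_left a ξ η := Subtype.ext (by
    change star (a.1 * ξ.1) * η.1 = star ξ.1 * (star a.1 * η.1)
    rw [star_mul, mul_assoc])

/-- The one-element frame `ν*` of `E = ν* ℱ^α`. -/
def frame (hν : α.IsShiftIsometry N ν) : Unit → α.corrSpace ν :=
  fun _ => ⟨star ν, hν.star_mem_corrSpace⟩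

theorem isFrame (hν : α.IsShiftIsometry N ν) : hν.correspondence.IsFrame hν.frame := by
  intro ξ
  obtain ⟨x, hx⟩ := ξ
  obtain ⟨a, ha, rfl⟩ := mem_corrSpace.1 hx
  rw [Fintype.sum_unique]
  refine Subtype.ext ?_
  change star ν * (star (star ν) * (star ν * a)) = star ν * a
  rw [star_star, ← mul_assoc, hν.star_mul_self, one_mul]

/-- The natural compatible representation of `E = ν* ℱ^α` on `𝒪_d^α`, given by the inclusions of
`ℱ^α` and of `E`. -/
def naturalRep (hν : α.IsShiftIsometry N ν) :
    hν.correspondence.CompatibleRep hν.frame α.fixedAlg where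
  π :=
    { toFun := fun a => ⟨a.1, ((α.mem_gaugeFixedAlg _).1 a.2).1⟩
      map_smul' := fun _ _ => rfl
      map_zero' := rfl
      map_add' := fun _ _ => rfl
      map_mul' := fun _ _ => rfl
      map_star' := fun _ => rfl }
  t :=
    { toFun := fun ξ => ⟨ξ.1, hν.corrSpace_le ξ.2⟩
      map_add' := fun _ _ => rfl
      map_smul' := fun _ _ => rfl }
  star_t_mul_t _ _ := rfl
  π_mul_t _ _ := rfl
  sum_frame := by
    rw [Fintype.sum_unique]
    refine Subtype.ext ?_
    change star ν * star (star ν) = 1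
    rw [star_star, hν.star_mul_self]

end IsShiftIsometry

end UnitaryRep

end

universe u w

/-! Existence of `ν`. The words of a fixed length in the `S_i` are isometries with orthogonal ranges
summing to `1`, so `ofMatrix` turns scalar matrices into elements of `𝒪_d` compatibly with products
and adjoints, and `δ` acts on matrices by `V ↦ α^l V (α^k)*` (`coaction_ofMatrix`). Since the `α^k`
are unitary, intertwiners give fixed points. An injective intertwiner `T` from `α^N` to `α^{N+1}` is
corrected by its polar decomposition: `T (T*T)^{-1/2}` is isometric, and it still intertwines
because the inverse square root is a polynomial in `T*T`.

Universality. The gauge action commutes with `δ`, so it grades `𝒪_d^α`, with degree-zero part `ℱ^α`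
and with `ν` of degree one. An element `x` of degree `k = n - m` equals `ν*^m (ν^m x ν*^n) ν^n`,
with the bracket in `ℱ^α`. By Fejér-type density (`dense_finiteDegree`), `ℱ^α` and `ν` therefore
determine a homomorphism, which gives uniqueness (`CircleAction.hom_ext`).

For existence, a compatible representation `(π, t)` yields `v = t(ν*)*`, which satisfies `v*v =
π(1)`, `vv* = π(νν*)` and `v π(a) = π(νaν*) v`. Together with the projection of `𝒪_d^α` onto `ℱ^α`
this is an `IsCovariantPair`. The formula above dictates the value `w_m* π(ν^m x ν*^n) w_n` at `x`,
where `w_n` is the `n`-th power of `v`. Covariance makes it depend only on `n - m` (`block_add`),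
and the relations of `v` make it multiplicative (`degreePart_mul`).

What remains is boundedness on sums of homogeneous elements. On degrees between `-n` and `n` there
are `2n + 1` components, each contractive, so the norm is at most `2n + 1`. This grows only linearly
in `n`, whereas the C*-identity squares norms while doubling `n`. Iterating and taking `2^j`-th
roots improves the bound to `1` (`norm_partialSum_le`), and the map extends by continuity. -/

noncomputable section

/-! ### Circle actions: spectral subspaces and Fourier components. -/

/-- A pointwise norm-continuous action of the circle on a unital C*-algebra. -/
structure CircleAction (M : Type*) [CStarAlgebra M] where
  /-- The automorphisms of the action. -/
  toHom : Circle → M →⋆ₐ[ℂ] M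
  mul_apply : ∀ z w x, toHom (z * w) x = toHom z (toHom w x)
  one_apply : ∀ x, toHom 1 x = x
  continuous_apply : ∀ x, Continuous fun z => toHom z x

namespace CircleAction

variable {M : Type*} [CStarAlgebra M] (γ : CircleAction M)

theorem norm_toHom_le (z : Circle) (x : M) : ‖γ.toHom z x‖ ≤ ‖x‖ :=
  NonUnitalStarAlgHom.norm_apply_le (γ.toHom z) x

/-- The elements of degree `k`. -/
def eigenspace (k : ℤ) : Submodule ℂ M where
  carrier := {x | ∀ z : Circle, γ.toHom z x = ((z ^ k : Circle) : ℂ) • x}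
  add_mem' hx hy z := by rw [map_add, hx z, hy z, smul_add]
  zero_mem' z := by simp
  smul_mem' c x hx z := by rw [map_smul, hx z, smul_comm]

variable {γ}

theorem mul_mem_eigenspace {k l : ℤ} {x y : M} (hx : x ∈ γ.eigenspace k)
    (hy : y ∈ γ.eigenspace l) : x * y ∈ γ.eigenspace (k + l) := fun z => by
  rw [map_mul, hx z, hy z, smul_mul_smul_comm, zpow_add, Circle.coe_mul]

theorem star_mem_eigenspace {k : ℤ} {x : M} (hx : x ∈ γ.eigenspace k) :
    star x ∈ γ.eigenspace (-k) := fun z => by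
  rw [map_star, hx z, star_smul, zpow_neg, Circle.coe_inv_eq_conj]; rfl

theorem one_mem_eigenspace : (1 : M) ∈ γ.eigenspace 0 := fun z => by simp

theorem pow_mem_eigenspace {k : ℤ} {x : M} (hx : x ∈ γ.eigenspace k) (n : ℕ) :
    x ^ n ∈ γ.eigenspace (n * k) := by
  induction n with
  | zero => simpa using one_mem_eigenspace
  | succ n ih =>
    rw [pow_succ]
    have := mul_mem_eigenspace ih hx
    rwa [show ((n : ℤ) * k + k) = ((n + 1 : ℕ) : ℤ) * k by push_cast; ring] at this

variable (γ)

/-- The orbit of `x`, as a function on the additive circle. -/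
def orbit (x : M) (t : UnitAddCircle) : M := γ.toHom (AddCircle.toCircle t) x

theorem continuous_orbit (x : M) : Continuous (γ.orbit x) :=
  (γ.continuous_apply x).comp AddCircle.continuous_toCircle

theorem integrable_orbit (x : M) : MeasureTheory.Integrable (γ.orbit x) AddCircle.haarAddCircle :=
  (γ.continuous_orbit x).integrable_of_hasCompactSupport (HasCompactSupport.of_compactSpace _)

/-- The degree `k` component of an element. -/
def comp (k : ℤ) : M →L[ℂ] M :=
  LinearMap.mkContinuous
    { toFun := fun x => fourierCoeff (γ.orbit x) k
      map_add' := fun x y => by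
        have h : γ.orbit (x + y) = γ.orbit x + γ.orbit y := funext fun t => map_add _ x y
        rw [h, fourierCoeff.add (γ.integrable_orbit x) (γ.integrable_orbit y)]; rfl
      map_smul' := fun c x => by
        have h : γ.orbit (c • x) = c • γ.orbit x := funext fun t => map_smul _ c x
        rw [h, RingHom.id_apply]; exact fourierCoeff.const_smul _ _ _ } 1
    (fun x => by
      refine (MeasureTheory.norm_integral_le_of_norm_le_const (C := ‖x‖)
        (Filter.Eventually.of_forall fun t => ?_)).trans ?_
      · rw [norm_smul, fourier_apply, Circle.norm_coe, one_mul]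
        exact γ.norm_toHom_le _ x
      · simp)

theorem comp_apply (k : ℤ) (x : M) : γ.comp k x = fourierCoeff (γ.orbit x) k := rfl

theorem norm_comp_le (k : ℤ) (x : M) : ‖γ.comp k x‖ ≤ ‖x‖ :=
  (ContinuousLinearMap.le_of_opNorm_le _ (LinearMap.mkContinuous_norm_le _ zero_le_one _) x).trans
    (one_mul _).le

/-- Applying the action under the integral translates the orbit, and Haar measure is translation
invariant. -/
theorem comp_mem (k : ℤ) (x : M) : γ.comp k x ∈ γ.eigenspace k := by
  intro z
  obtain ⟨s, rfl⟩ := (AddCircle.homeomorphCircle (T := 1) one_ne_zero).surjective z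
  rw [AddCircle.homeomorphCircle_apply, comp_apply, fourierCoeff]
  let L : M →L[ℂ] M := ⟨(γ.toHom (AddCircle.toCircle s) : M →ₐ[ℂ] M).toLinearMap,
    starAlgHom_continuous _⟩
  have hi : MeasureTheory.Integrable (fun t => fourier (-k) t • γ.orbit x t)
      (AddCircle.haarAddCircle (T := 1)) := by
    refine Continuous.integrable_of_hasCompactSupport ?_ (HasCompactSupport.of_compactSpace _)
    exact (fourier (-k)).continuous.smul (γ.continuous_orbit x)
  have h1 := L.integral_comp_comm hi
  refine h1.symm.trans ?_
  rw [← MeasureTheory.integral_smul]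
  -- Substituting `s + t` for `t` on the right makes the integrands agree, since `z^k` cancels the
  -- value of the character `-k` at `s`.
  rw [← MeasureTheory.integral_add_left_eq_self (μ := AddCircle.haarAddCircle)
    (fun t => ((AddCircle.toCircle s ^ k : Circle) : ℂ) • (fourier (-k)) t • γ.orbit x t) s]
  refine MeasureTheory.integral_congr_ae (Filter.Eventually.of_forall fun t => ?_)
  change γ.toHom _ (fourier (-k) t • γ.orbit x t) = _
  simp only [orbit, map_smul, AddCircle.toCircle_add, γ.mul_apply, smul_smul]
  congr 1
  rw [fourier_apply, fourier_apply, ← AddCircle.toCircle_zsmul, ← Circle.coe_mul,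
    ← AddCircle.toCircle_add]
  congr 2
  simp only [smul_add, neg_smul]; abel

/-- The orbit of a homogeneous element is a character times a constant, so this is orthogonality of
characters. -/
theorem comp_of_mem {k : ℤ} {x : M} (hx : x ∈ γ.eigenspace k) (j : ℤ) :
    γ.comp j x = if j = k then x else 0 := by
  have h : γ.orbit x = fun t => fourier k t • x := funext fun t => by
    rw [orbit, hx, fourier_apply, AddCircle.toCircle_zsmul]
  have h2 : fourierCoeff (fourier k : C(UnitAddCircle, ℂ)) j • x = γ.comp j x := by
    rw [comp_apply, h, fourierCoeff, fourierCoeff, ← integral_smul_const]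
    simp only [smul_assoc]
  rw [← h2, fourierCoeff_fourier, Pi.single_apply]
  split_ifs <;> simp

/-- The scalar function `t ↦ f (γ_t x)` is continuous with vanishing Fourier coefficients, hence
zero; its value at `0` is `f x`. Testing with functionals avoids summing a vector-valued Fourier
series. -/
theorem dual_eq_zero_of_comp_eq_zero {x : M} (f : StrongDual ℂ M)
    (h : ∀ k, f (γ.comp k x) = 0) : f x = 0 := by
  let g : C(UnitAddCircle, ℂ) :=
    ⟨fun t => f (γ.orbit x t), f.continuous.comp (γ.continuous_orbit x)⟩
  have hg : fourierCoeff g = 0 := by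
    funext k
    have hi : MeasureTheory.Integrable (fun t => fourier (-k) t • γ.orbit x t)
        (AddCircle.haarAddCircle (T := 1)) := by
      refine Continuous.integrable_of_hasCompactSupport ?_ (HasCompactSupport.of_compactSpace _)
      exact (fourier (-k)).continuous.smul (γ.continuous_orbit x)
    rw [Pi.zero_apply, ← h k, comp_apply, fourierCoeff, fourierCoeff, ← f.integral_comp_comm hi]
    simp [g]
  have hs := has_pointwise_sum_fourier_series_of_summable (f := g)
    (by rw [hg]; exact summable_zero) 0
  rw [hg] at hs
  have h0 : g 0 = 0 := hs.unique (by simp [hasSum_zero])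
  have h1 : γ.orbit x 0 = x := by rw [orbit, AddCircle.toCircle_zero, γ.one_apply]
  change f (γ.orbit x 0) = 0 at h0
  rwa [h1] at h0

/-! ### Elements of finite degree and their density. -/

/-- The span of the elements of degrees between `-n` and `n`. -/
def degreeLE (n : ℕ) : Submodule ℂ M :=
  Submodule.span ℂ {x | ∃ k : ℤ, k.natAbs ≤ n ∧ x ∈ γ.eigenspace k}

theorem degreeLE_mono {m n : ℕ} (h : m ≤ n) : γ.degreeLE m ≤ γ.degreeLE n :=
  Submodule.span_mono fun _ ⟨k, hk, hx⟩ => ⟨k, hk.trans h, hx⟩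

variable {γ}

theorem mem_degreeLE {k : ℤ} {x : M} (hx : x ∈ γ.eigenspace k) : x ∈ γ.degreeLE k.natAbs :=
  Submodule.subset_span ⟨k, le_rfl, hx⟩

theorem mul_mem_degreeLE {m n : ℕ} {x y : M} (hx : x ∈ γ.degreeLE m) (hy : y ∈ γ.degreeLE n) :
    x * y ∈ γ.degreeLE (m + n) := by
  have h := Submodule.mul_mem_mul hx hy
  rw [degreeLE, degreeLE, Submodule.span_mul_span] at h
  refine Submodule.span_mono ?_ h
  rintro _ ⟨x, ⟨k, hk, hx⟩, y, ⟨l, hl, hy⟩, rfl⟩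
  exact ⟨k + l, (Int.natAbs_add_le k l).trans (add_le_add hk hl), mul_mem_eigenspace hx hy⟩

theorem star_mem_degreeLE {n : ℕ} {x : M} (hx : x ∈ γ.degreeLE n) : star x ∈ γ.degreeLE n := by
  induction hx using Submodule.span_induction with
  | mem x hx =>
    obtain ⟨k, hk, hx⟩ := hx
    exact Submodule.subset_span ⟨-k, by rwa [Int.natAbs_neg], star_mem_eigenspace hx⟩
  | zero => simp
  | add x y _ _ hx hy => rw [star_add]; exact add_mem hx hy
  | smul c x _ hx => rw [star_smul]; exact Submodule.smul_mem _ _ hx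

variable (γ)

/-- The span of the homogeneous elements. -/
def finiteDegree : Submodule ℂ M where
  carrier := {x | ∃ n, x ∈ γ.degreeLE n}
  add_mem' := fun ⟨m, hm⟩ ⟨n, hn⟩ => ⟨max m n, add_mem (γ.degreeLE_mono (le_max_left m n) hm)
    (γ.degreeLE_mono (le_max_right m n) hn)⟩
  zero_mem' := ⟨0, zero_mem _⟩
  smul_mem' c _ := fun ⟨n, hn⟩ => ⟨n, Submodule.smul_mem _ c hn⟩

/-- Hahn–Banach on the quotient by the closure: a functional pulled back from there kills every
Fourier component of `x`, hence `x` itself. -/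
theorem dense_finiteDegree : Dense (γ.finiteDegree : Set M) := by
  rw [Submodule.dense_iff_topologicalClosure_eq_top, eq_top_iff]
  intro x _
  have : IsClosed (γ.finiteDegree.topologicalClosure : Set M) :=
    γ.finiteDegree.isClosed_topologicalClosure
  rw [← Submodule.Quotient.mk_eq_zero]
  refine SeparatingDual.eq_zero_of_forall_dual_eq_zero (R := ℂ) fun g => ?_
  refine γ.dual_eq_zero_of_comp_eq_zero (g.comp γ.finiteDegree.topologicalClosure.mkQL) fun k => ?_
  have h : Submodule.Quotient.mk (p := γ.finiteDegree.topologicalClosure) (γ.comp k x) = 0 :=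
    (Submodule.Quotient.mk_eq_zero _).2 (γ.finiteDegree.le_topologicalClosure
      ⟨k.natAbs, mem_degreeLE (γ.comp_mem k x)⟩)
  exact (congrArg g h).trans (map_zero g)

theorem closed_induction {C : M → Prop} (hC : IsClosed {x | C x}) (h : ∀ n, ∀ x ∈ γ.degreeLE n, C x)
    (x : M) : C x :=
  γ.dense_finiteDegree.induction (fun x ⟨n, hn⟩ => h n x hn) hC x

end CircleAction

end

noncomputable section

/-! ### Reconstruction of a homomorphism from its degree-zero part and the image of an isometry of
degree one. -/

namespace CircleAction

variable {M : Type*} [CStarAlgebra M] {B : Type*} [NonUnitalCStarAlgebra B]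

/-- Data from which a `*`-homomorphism on `M` is reconstructed: an isometry `ν` of degree one, a
contraction `π` that is a `*`-homomorphism on the elements of degree zero and kills those of any
other degree, and a partial isometry `v` that implements the same endomorphism as `ν`. -/
structure IsCovariantPair (γ : CircleAction M) (ν : M) (π : M →L[ℂ] B) (v : B) : Prop where
  isometry : star ν * ν = 1
  mem : ν ∈ γ.eigenspace 1
  norm_le : ∀ x, ‖π x‖ ≤ ‖x‖
  map_mul : ∀ x ∈ γ.eigenspace 0, ∀ y ∈ γ.eigenspace 0, π (x * y) = π x * π y
  map_star : ∀ x ∈ γ.eigenspace 0, π (star x) = star (π x)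
  map_eigenspace : ∀ k : ℤ, k ≠ 0 → ∀ x ∈ γ.eigenspace k, π x = 0
  star_mul_self : star v * v = π 1
  mul_star_self : v * star v = π (ν * star ν)
  covariant : ∀ x ∈ γ.eigenspace 0, v * π x = π (ν * x * star ν) * v

/-- The powers of `v`, starting with the projection `p`. -/
def cutPow (p v : B) : ℕ → B
  -- `B` need not have a unit; the projection `π 1` will take the place of `v ^ 0`.
  | 0 => p
  | n + 1 => v * cutPow p v n

namespace IsCovariantPair

variable {γ : CircleAction M} {ν : M} {π : M →L[ℂ] B} {v : B}

theorem star_pow_mul_pow (h : γ.IsCovariantPair ν π v) (n : ℕ) : star (ν ^ n) * ν ^ n = 1 := by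
  induction n with
  | zero => simp
  | succ n ih =>
    rw [pow_succ', star_mul, mul_assoc, ← mul_assoc (star ν), h.isometry, one_mul, ih]

/-- Only an inequality, since `M` may be zero. -/
theorem norm_one_le : ‖(1 : M)‖ ≤ 1 := by
  have h : ‖(1 : M)‖ = ‖(1 : M)‖ * ‖(1 : M)‖ := by
    simpa using CStarRing.norm_star_mul_self (x := (1 : M))
  nlinarith [norm_nonneg (1 : M)]

theorem norm_pow_le (h : γ.IsCovariantPair ν π v) (n : ℕ) : ‖ν ^ n‖ ≤ 1 := by
  have h1 := CStarRing.norm_star_mul_self (x := ν ^ n)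
  rw [h.star_pow_mul_pow] at h1
  nlinarith [norm_nonneg (ν ^ n), norm_one_le (M := M)]

theorem pow_mem (h : γ.IsCovariantPair ν π v) (n : ℕ) : ν ^ n ∈ γ.eigenspace n := by
  simpa using pow_mem_eigenspace h.mem n

theorem compress_mem (h : γ.IsCovariantPair ν π v) {k : ℤ} {x : M} (hx : x ∈ γ.eigenspace k)
    (m n : ℕ) : ν ^ m * x * star (ν ^ n) ∈ γ.eigenspace (m + k - n) :=
  mul_mem_eigenspace (mul_mem_eigenspace (h.pow_mem m) hx) (star_mem_eigenspace (h.pow_mem n))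

theorem compress_mem_zero (h : γ.IsCovariantPair ν π v) {m n : ℕ} {x : M}
    (hx : x ∈ γ.eigenspace ((n : ℤ) - m)) : ν ^ m * x * star (ν ^ n) ∈ γ.eigenspace 0 := by
  have := h.compress_mem hx m n
  rwa [show (m : ℤ) + (n - m) - n = 0 by ring] at this

/-- With `p = π 1` a projection and `v*v = p`, the difference `d = vp - v` has `d*d = 0`. This
replaces the unit of `B` on the right of `v`. -/
theorem mul_map_one (h : γ.IsCovariantPair ν π v) : v * π 1 = v := by
  have hp : π 1 * π 1 = π 1 := by
    rw [← h.map_mul 1 one_mem_eigenspace 1 one_mem_eigenspace, one_mul]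
  have hs : star (π 1) = π 1 := by rw [← h.map_star 1 one_mem_eigenspace, star_one]
  have h0 : star (v * π 1 - v) * (v * π 1 - v) = 0 := by
    rw [star_sub, star_mul, hs]
    simp only [sub_mul, mul_sub, mul_assoc]
    rw [← mul_assoc (star v) v, h.star_mul_self]
    simp only [hp, sub_self]
  exact sub_eq_zero.1 (CStarRing.star_mul_self_eq_zero_iff _ |>.1 h0)

/-- Here `v = vv*v = π(νν*) v`, and `π 1` is absorbed by `π(νν*)`. -/
theorem map_one_mul (h : γ.IsCovariantPair ν π v) : π 1 * v = v := by
  have hν : ν * star ν ∈ γ.eigenspace 0 := mul_mem_eigenspace h.mem (star_mem_eigenspace h.mem)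
  have h1 : π (ν * star ν) * v = v := by
    rw [← h.mul_star_self, mul_assoc, h.star_mul_self, h.mul_map_one]
  rw [← h1, ← mul_assoc, ← h.map_mul 1 one_mem_eigenspace _ hν, one_mul]

theorem map_one_mul_map (h : γ.IsCovariantPair ν π v) {x : M} (hx : x ∈ γ.eigenspace 0) :
    π 1 * π x = π x := by rw [← h.map_mul 1 one_mem_eigenspace x hx, one_mul]

theorem map_mul_map_one (h : γ.IsCovariantPair ν π v) {x : M} (hx : x ∈ γ.eigenspace 0) :
    π x * π 1 = π x := by rw [← h.map_mul x hx 1 one_mem_eigenspace, mul_one]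

theorem map_one_mul_cutPow (h : γ.IsCovariantPair ν π v) (n : ℕ) :
    π 1 * cutPow (π 1) v n = cutPow (π 1) v n := by
  cases n with
  | zero => exact h.map_one_mul_map one_mem_eigenspace
  | succ n => rw [cutPow, ← mul_assoc, h.map_one_mul]

theorem star_cutPow_mul (h : γ.IsCovariantPair ν π v) (n : ℕ) :
    star (cutPow (π 1) v n) * cutPow (π 1) v n = π 1 := by
  induction n with
  | zero =>
    rw [cutPow, ← h.map_star 1 one_mem_eigenspace, star_one, h.map_one_mul_map one_mem_eigenspace]
  | succ n ih =>
    rw [cutPow, star_mul, mul_assoc, ← mul_assoc (star v), h.star_mul_self,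
      h.map_one_mul_cutPow, ih]

theorem norm_cutPow_le (h : γ.IsCovariantPair ν π v) (n : ℕ) : ‖cutPow (π 1) v n‖ ≤ 1 := by
  have h1 := CStarRing.norm_star_mul_self (x := cutPow (π 1) v n)
  rw [h.star_cutPow_mul] at h1
  nlinarith [norm_nonneg (cutPow (π 1) v n), norm_one_le (M := M), h.norm_le 1]

/-- Inductive step: `v π(q) v* = π(νqν*) vv* = π(νqν*) π(νν*)`, and the product inside `π` collapses
because `ν` is an isometry. -/
theorem cutPow_mul_star (h : γ.IsCovariantPair ν π v) (n : ℕ) :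
    cutPow (π 1) v n * star (cutPow (π 1) v n) = π (ν ^ n * star (ν ^ n)) := by
  induction n with
  | zero =>
    simp [cutPow, ← h.map_star 1 one_mem_eigenspace, h.map_one_mul_map one_mem_eigenspace]
  | succ n ih =>
    have hm : ν ^ n * star (ν ^ n) ∈ γ.eigenspace 0 := by
      simpa using h.compress_mem_zero (m := n) (n := n) (x := 1) (by simpa using one_mem_eigenspace)
    have hm' : ν * (ν ^ n * star (ν ^ n)) * star ν ∈ γ.eigenspace 0 := by
      simpa using h.compress_mem_zero (m := 1) (n := 1) (x := _) (by simpa using hm)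
    rw [cutPow, star_mul, mul_assoc, ← mul_assoc (cutPow (π 1) v n), ih, ← mul_assoc,
      h.covariant _ hm, mul_assoc, h.mul_star_self, ← h.map_mul _ hm' _
        (mul_mem_eigenspace h.mem (star_mem_eigenspace h.mem)), pow_succ', star_mul]
    simp only [mul_assoc]
    rw [← mul_assoc (star ν) ν, h.isometry, one_mul]

end IsCovariantPair

/-- The map `x ↦ w_m* π(ν^m x ν*^n) w_n`, where `w` are the powers of `v`. -/
def block (ν : M) (π : M →L[ℂ] B) (v : B) (m n : ℕ) : M →L[ℂ] B :=
  (ContinuousLinearMap.mul ℂ B (star (cutPow (π 1) v m))).comp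
    (((ContinuousLinearMap.mul ℂ B).flip (cutPow (π 1) v n)).comp
      (π.comp ((ContinuousLinearMap.mul ℂ M (ν ^ m)).comp
        ((ContinuousLinearMap.mul ℂ M).flip (star (ν ^ n))))))

theorem block_apply (ν : M) (π : M →L[ℂ] B) (v : B) (m n : ℕ) (x : M) :
    block ν π v m n x = star (cutPow (π 1) v m) *
      (π (ν ^ m * x * star (ν ^ n)) * cutPow (π 1) v n) := by
  rw [mul_assoc (ν ^ m)]; rfl

/-- The component of degree `k` of the reconstructed homomorphism. -/
def degreePart (ν : M) (π : M →L[ℂ] B) (v : B) (k : ℤ) : M →L[ℂ] B :=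
  -- The negative and positive parts of `k`: the smallest exponents `m`, `n` with `n - m = k`, so
  -- that compression moves degree `k` to degree zero.
  block ν π v (-k).toNat k.toNat

/-- The sum of the components of degrees between `-n` and `n`. -/
def partialSum (ν : M) (π : M →L[ℂ] B) (v : B) (n : ℕ) : M →L[ℂ] B :=
  ∑ k ∈ Finset.Icc (-n : ℤ) n, degreePart ν π v k

namespace IsCovariantPair

variable {γ : CircleAction M} {ν : M} {π : M →L[ℂ] B} {v : B}

theorem norm_block_le (h : γ.IsCovariantPair ν π v) (m n : ℕ) (x : M) :
    ‖block ν π v m n x‖ ≤ ‖x‖ := by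
  have hw := h.norm_cutPow_le m
  rw [← norm_star] at hw
  have h2 := h.norm_pow_le n
  rw [← norm_star] at h2
  rw [block_apply]
  calc _ ≤ ‖star (cutPow (π 1) v m)‖ * (‖π (ν ^ m * x * star (ν ^ n))‖ * ‖cutPow (π 1) v n‖) :=
        (norm_mul_le _ _).trans (by gcongr; exact norm_mul_le _ _)
    _ ≤ 1 * (‖ν ^ m * x * star (ν ^ n)‖ * 1) := by
        gcongr
        · exact h.norm_le _
        · exact h.norm_cutPow_le n
    _ ≤ 1 * ((1 * ‖x‖ * 1) * 1) := by
        gcongr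
        refine (norm_mul_le _ _).trans ?_
        gcongr
        refine (norm_mul_le _ _).trans ?_
        gcongr
        exact h.norm_pow_le m
    _ = ‖x‖ := by ring

/-- The extra `ν … ν*` inside `π` becomes an extra `v` to the left of `π` by covariance, and there
it meets `v*` and disappears in `v*v = π 1`. -/
theorem block_succ (h : γ.IsCovariantPair ν π v) {m n : ℕ} {x : M}
    (hx : x ∈ γ.eigenspace ((n : ℤ) - m)) :
    block ν π v (m + 1) (n + 1) x = block ν π v m n x := by
  have hy := h.compress_mem_zero hx
  rw [block_apply, block_apply, cutPow, cutPow, pow_succ', pow_succ', star_mul, star_mul]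
  rw [show ν * ν ^ m * x * (star (ν ^ n) * star ν) = ν * (ν ^ m * x * star (ν ^ n)) * star ν by
    simp only [mul_assoc]]
  rw [← mul_assoc (π _) v, ← h.covariant _ hy, mul_assoc, mul_assoc v, ← mul_assoc (star v) v,
    h.star_mul_self, ← mul_assoc (π 1), h.map_one_mul_map hy]

theorem block_add (h : γ.IsCovariantPair ν π v) {m n : ℕ} {x : M}
    (hx : x ∈ γ.eigenspace ((n : ℤ) - m)) (j : ℕ) :
    block ν π v (m + j) (n + j) x = block ν π v m n x := by
  induction j with
  | zero => rfl
  | succ j ih =>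
    rw [← ih, ← add_assoc, ← add_assoc]
    exact h.block_succ (by push_cast; rwa [add_sub_add_right_eq_sub])

/-- Any exponents with difference `k` arise from the minimal ones by adding `min m n` to both. The
freedom to choose them is what makes products computable. -/
theorem degreePart_eq_block (h : γ.IsCovariantPair ν π v) {k : ℤ} {m n : ℕ} (hk : k = n - m) {x : M}
    (hx : x ∈ γ.eigenspace k) : degreePart ν π v k x = block ν π v m n x := by
  have := h.block_add (m := (-k).toNat) (n := k.toNat) (x := x)
    (by rwa [show ((k.toNat : ℤ) - (-k).toNat) = k by omega]) (min m n)
  rw [degreePart, ← this]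
  congr 2 <;> omega

/-- Compression by the exponents of `j` shifts degree `k` to `k - j ≠ 0`, where `π` vanishes. Thus
`degreePart` selects its own component without any prior decomposition of `x`. -/
theorem degreePart_of_ne (h : γ.IsCovariantPair ν π v) {j k : ℤ} (hjk : j ≠ k) {x : M}
    (hx : x ∈ γ.eigenspace k) : degreePart ν π v j x = 0 := by
  rw [degreePart, block_apply, h.map_eigenspace _ _ _ (h.compress_mem hx _ _), zero_mul, mul_zero]
  omega

/-- Choose the exponents so that the right one of `x` equals the left one of `y`. The inner factor
`w_n w_n*` is then `π(ν^n ν*^n)`, everything between the outer powers lies in the image of degree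
zero, and `ν*^n ν^n = 1` leaves the compression of `xy`. -/
theorem degreePart_mul (h : γ.IsCovariantPair ν π v) {k l : ℤ} {x y : M}
    (hx : x ∈ γ.eigenspace k) (hy : y ∈ γ.eigenspace l) :
    degreePart ν π v (k + l) (x * y) = degreePart ν π v k x * degreePart ν π v l y := by
  obtain ⟨m, n, r, hk, hl⟩ : ∃ m n r : ℕ, k = n - m ∧ l = r - n :=
    -- The first exponent is large enough for `m + k` and `m + k + l` to be nonnegative, so the
    -- truncations lose nothing.
    ⟨l.natAbs + k.natAbs, (l.natAbs + k.natAbs + k).toNat, (l.natAbs + k.natAbs + k + l).toNat,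
      by omega, by omega⟩
  have hkl : k + l = r - m := by omega
  rw [h.degreePart_eq_block hk hx, h.degreePart_eq_block hl hy,
    h.degreePart_eq_block hkl (mul_mem_eigenspace hx hy), block_apply, block_apply, block_apply]
  have hx' := h.compress_mem_zero (hk ▸ hx)
  have hy' := h.compress_mem_zero (hl ▸ hy)
  have hn : ν ^ n * star (ν ^ n) ∈ γ.eigenspace 0 := by
    simpa using h.compress_mem_zero (m := n) (n := n) (x := 1) (by simpa using one_mem_eigenspace)
  simp only [mul_assoc]
  rw [← mul_assoc (cutPow (π 1) v n), h.cutPow_mul_star, ← mul_assoc (π (ν ^ n * star (ν ^ n)))]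
  simp only [mul_assoc] at hx' hy' hn ⊢
  rw [← mul_assoc (π (ν ^ n * star (ν ^ n))), ← h.map_mul _ hn _ hy', ← mul_assoc (π _) (π _),
    ← h.map_mul _ hx' _ (mul_mem_eigenspace hn hy')]
  congr 3
  simp only [mul_assoc]
  rw [← mul_assoc (star (ν ^ n)) (ν ^ n), h.star_pow_mul_pow, one_mul,
    ← mul_assoc (star (ν ^ n)) (ν ^ n), h.star_pow_mul_pow, one_mul]

theorem degreePart_star (h : γ.IsCovariantPair ν π v) {k : ℤ} {x : M} (hx : x ∈ γ.eigenspace k) :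
    degreePart ν π v (-k) (star x) = star (degreePart ν π v k x) := by
  have hx' := h.compress_mem_zero (m := (-k).toNat) (n := k.toNat) (x := x)
    (by rwa [show ((k.toNat : ℤ) - (-k).toNat) = k by omega])
  rw [degreePart, degreePart, block_apply, block_apply, star_mul, star_mul, star_star, neg_neg,
    ← h.map_star _ hx', star_mul, star_mul, star_star]
  simp only [mul_assoc]

theorem partialSum_of_mem (h : γ.IsCovariantPair ν π v) {k : ℤ} {n : ℕ} (hk : k.natAbs ≤ n) {x : M}
    (hx : x ∈ γ.eigenspace k) : partialSum ν π v n x = degreePart ν π v k x := by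
  rw [partialSum, _root_.sum_apply]
  refine Finset.sum_eq_single k (fun j _ hj => h.degreePart_of_ne hj hx) fun hk' => ?_
  exact absurd (Finset.mem_Icc.2 (by omega)) hk'

theorem partialSum_mono (h : γ.IsCovariantPair ν π v) {n N : ℕ} (hn : n ≤ N) {x : M}
    (hx : x ∈ γ.degreeLE n) : partialSum ν π v N x = partialSum ν π v n x := by
  induction hx using Submodule.span_induction with
  | mem x hx =>
    obtain ⟨k, hk, hx⟩ := hx
    rw [h.partialSum_of_mem hk hx, h.partialSum_of_mem (hk.trans hn) hx]
  | zero => simp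
  | add x y _ _ hx hy => rw [map_add, map_add, hx, hy]
  | smul c x _ hx => rw [map_smul, map_smul, hx]

theorem partialSum_star (h : γ.IsCovariantPair ν π v) {n : ℕ} {x : M} (hx : x ∈ γ.degreeLE n) :
    partialSum ν π v n (star x) = star (partialSum ν π v n x) := by
  induction hx using Submodule.span_induction with
  | mem x hx =>
    obtain ⟨k, hk, hx⟩ := hx
    rw [h.partialSum_of_mem hk hx, h.partialSum_of_mem (by rwa [Int.natAbs_neg])
      (star_mem_eigenspace hx), h.degreePart_star hx]
  | zero => simp
  | add x y _ _ hx hy => rw [star_add, map_add, map_add, hx, hy, star_add]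
  | smul c x _ hx => rw [star_smul, map_smul, map_smul, hx, star_smul]

theorem partialSum_mul (h : γ.IsCovariantPair ν π v) {m n : ℕ} {x y : M}
    (hx : x ∈ γ.degreeLE m) (hy : y ∈ γ.degreeLE n) :
    partialSum ν π v (m + n) (x * y) = partialSum ν π v m x * partialSum ν π v n y := by
  induction hx using Submodule.span_induction with
  | zero => simp
  | add x x' _ _ hx hx' => rw [add_mul, map_add, map_add, hx, hx', add_mul]
  | smul c x _ hx => rw [smul_mul_assoc, map_smul, map_smul, hx, smul_mul_assoc]
  | mem x hx =>
    obtain ⟨k, hk, hx⟩ := hx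
    induction hy using Submodule.span_induction with
    | zero => simp
    | add y y' _ _ hy hy' => rw [mul_add, map_add, map_add, hy, hy', mul_add]
    | smul c y _ hy => rw [mul_smul_comm, map_smul, map_smul, hy, mul_smul_comm]
    | mem y hy =>
      obtain ⟨l, hl, hy⟩ := hy
      rw [h.partialSum_of_mem hk hx, h.partialSum_of_mem hl hy, h.partialSum_of_mem
        ((Int.natAbs_add_le k l).trans (add_le_add hk hl)) (mul_mem_eigenspace hx hy),
        h.degreePart_mul hx hy]

/-- A crude bound from counting `2n + 1` contractive components; all that matters is that it is
linear in `n`. -/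
theorem norm_partialSum_le_mul (h : γ.IsCovariantPair ν π v) (n : ℕ) (x : M) :
    ‖partialSum ν π v n x‖ ≤ (2 * n + 1) * ‖x‖ := by
  rw [partialSum, _root_.sum_apply]
  refine (norm_sum_le_of_le _ fun k _ => h.norm_block_le _ _ x).trans ?_
  rw [Finset.sum_const, Int.card_Icc, nsmul_eq_mul]
  gcongr
  rw [show ((n : ℤ) + 1 - -n).toNat = 2 * n + 1 by omega]
  push_cast; rfl

/-- Passing from `x` to `x*x` squares both norms by the C*-identity but only doubles the degree
bound, which accounts for the factor `2 ^ j`. -/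
theorem norm_partialSum_pow_le (h : γ.IsCovariantPair ν π v) (j : ℕ) {n : ℕ} {x : M}
    (hx : x ∈ γ.degreeLE n) :
    ‖partialSum ν π v n x‖ ^ 2 ^ j ≤ (2 * n * 2 ^ j + 1) * ‖x‖ ^ 2 ^ j := by
  induction j generalizing n x with
  | zero => simpa using h.norm_partialSum_le_mul n x
  | succ j ih =>
    have h1 : ‖partialSum ν π v n x‖ ^ 2 = ‖partialSum ν π v (n + n) (star x * x)‖ := by
      rw [h.partialSum_mul (star_mem_degreeLE hx) hx, h.partialSum_star hx,
        CStarRing.norm_star_mul_self, sq]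
    have h2 : ‖x‖ ^ 2 = ‖star x * x‖ := by rw [CStarRing.norm_star_mul_self, sq]
    rw [pow_succ' 2 j, pow_mul, pow_mul, h1, h2]
    refine (ih (mul_mem_degreeLE (star_mem_degreeLE hx) hx)).trans (le_of_eq ?_)
    push_cast; ring

end IsCovariantPair

/-- If `r > s > 0`, then `(r/s)^(2^j)` grows exponentially in `2^j` and outruns the linear factor;
if `s = 0`, the case `j = 0` already decides. -/
theorem le_of_pow_two_pow_le {r s c : ℝ} (hs : 0 ≤ s)
    (h : ∀ j : ℕ, r ^ 2 ^ j ≤ (c * 2 ^ j + 1) * s ^ 2 ^ j) : r ≤ s := by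
  by_contra! hrs
  rcases hs.eq_or_lt with rfl | hs
  · have := h 0
    simp at this
    linarith
  have hq : 1 < r / s := (one_lt_div hs).2 hrs
  have h1 := (tendsto_pow_const_div_const_pow_of_one_lt 1 hq).const_mul (c + 1)
  rw [mul_zero] at h1
  have h2 := h1.comp (tendsto_pow_atTop_atTop_of_one_lt (one_lt_two : (1 : ℕ) < 2))
  obtain ⟨j, hj⟩ := (h2.eventually (gt_mem_nhds one_pos)).exists
  have hp : 0 < (r / s) ^ 2 ^ j := by positivity
  rw [Function.comp_apply, pow_one, ← mul_div_assoc, div_lt_one hp, div_pow,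
    lt_div_iff₀ (by positivity)] at hj
  have h3 : (c * 2 ^ j + 1) * s ^ 2 ^ j ≤ (c + 1) * ((2 ^ j : ℕ) : ℝ) * s ^ 2 ^ j := by
    gcongr
    push_cast
    nlinarith [one_le_pow₀ (one_le_two : (1 : ℝ) ≤ 2) (n := j)]
  linarith [h j]

namespace IsCovariantPair

variable {γ : CircleAction M} {ν : M} {π : M →L[ℂ] B} {v : B}

theorem norm_partialSum_le (h : γ.IsCovariantPair ν π v) {n : ℕ} {x : M}
    (hx : x ∈ γ.degreeLE n) : ‖partialSum ν π v n x‖ ≤ ‖x‖ :=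
  le_of_pow_two_pow_le (norm_nonneg x) fun j => h.norm_partialSum_pow_le j hx

/-- The reconstructed homomorphism on the elements of finite degree. -/
def finiteHom (h : γ.IsCovariantPair ν π v) : γ.finiteDegree →L[ℂ] B :=
  have key : ∀ (x : γ.finiteDegree) {n : ℕ}, x.1 ∈ γ.degreeLE n →
      partialSum ν π v (Classical.choose x.2) x.1 = partialSum ν π v n x.1 := fun x n hn => by
    rw [← h.partialSum_mono (le_max_left _ n) (Classical.choose_spec x.2),
      ← h.partialSum_mono (le_max_right _ n) hn]
  LinearMap.mkContinuous
    { toFun := fun x => partialSum ν π v (Classical.choose x.2) x.1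
      map_add' := fun x y => by
        have hx := γ.degreeLE_mono (le_max_left _ (Classical.choose y.2))
          (Classical.choose_spec x.2)
        have hy := γ.degreeLE_mono (le_max_right (Classical.choose x.2) _)
          (Classical.choose_spec y.2)
        rw [key (x + y) (add_mem hx hy), key x hx, key y hy]
        exact map_add _ _ _
      map_smul' := fun c x => by
        have hx := Classical.choose_spec x.2
        rw [key (c • x) (Submodule.smul_mem _ c hx), key x hx]
        exact map_smul _ _ _ } 1
    (fun x => by rw [one_mul]; exact h.norm_partialSum_le (Classical.choose_spec x.2))

theorem finiteHom_apply (h : γ.IsCovariantPair ν π v) {n : ℕ} {x : M} (hx : x ∈ γ.degreeLE n) :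
    h.finiteHom ⟨x, n, hx⟩ = partialSum ν π v n x := by
  have hc := Classical.choose_spec (⟨n, hx⟩ : ∃ n, x ∈ γ.degreeLE n)
  change partialSum ν π v (Classical.choose _) x = _
  rw [← h.partialSum_mono (le_max_left _ n) hc, ← h.partialSum_mono (le_max_right _ n) hx]

/-- The continuous linear map underlying the reconstructed homomorphism. -/
def extension (h : γ.IsCovariantPair ν π v) : M →L[ℂ] B :=
  h.finiteHom.extend γ.finiteDegree.subtypeL

theorem extension_apply (h : γ.IsCovariantPair ν π v) {n : ℕ} {x : M} (hx : x ∈ γ.degreeLE n) :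
    h.extension x = partialSum ν π v n x := by
  rw [← h.finiteHom_apply hx]
  exact h.finiteHom.extend_eq (e := γ.finiteDegree.subtypeL) γ.dense_finiteDegree.denseRange_val
    isUniformEmbedding_subtype_val.isUniformInducing ⟨x, n, hx⟩

/-- The `*`-homomorphism on `M` reconstructed from a covariant pair. -/
def hom (h : γ.IsCovariantPair ν π v) : M →⋆ₙₐ[ℂ] B where
  toFun := h.extension
  map_smul' := map_smul h.extension
  map_zero' := map_zero h.extension
  map_add' := map_add h.extension
  map_mul' x y := by
    induction x using γ.closed_induction with
    | hC => exact isClosed_eq (by fun_prop) (by fun_prop)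
    | h m x hx =>
      induction y using γ.closed_induction with
      | hC => exact isClosed_eq (by fun_prop) (by fun_prop)
      | h n y hy =>
        rw [h.extension_apply hx, h.extension_apply hy, h.extension_apply (mul_mem_degreeLE hx hy),
          h.partialSum_mul hx hy]
  map_star' x := by
    induction x using γ.closed_induction with
    | hC => exact isClosed_eq (by fun_prop) (by fun_prop)
    | h n x hx =>
      rw [h.extension_apply hx, h.extension_apply (star_mem_degreeLE hx), h.partialSum_star hx]

theorem hom_apply (h : γ.IsCovariantPair ν π v) {x : M} (hx : x ∈ γ.eigenspace 0) :
    h.hom x = π x := by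
  refine (h.extension_apply (mem_degreeLE hx)).trans ?_
  rw [h.partialSum_of_mem le_rfl hx, degreePart, block_apply]
  simp [cutPow, ← h.map_star 1 one_mem_eigenspace, h.map_one_mul_map hx, h.map_mul_map_one hx]

/-- In degree one the formula reads `π(1) π(νν*) v π(1)`, which is `vv*v = v`. -/
theorem hom_isometry (h : γ.IsCovariantPair ν π v) : h.hom ν = v := by
  refine (h.extension_apply (mem_degreeLE h.mem)).trans ?_
  have hν : ν * star ν ∈ γ.eigenspace 0 := mul_mem_eigenspace h.mem (star_mem_eigenspace h.mem)
  rw [h.partialSum_of_mem le_rfl h.mem, degreePart, block_apply]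
  simp only [Int.reduceNeg, Int.toNat_one, cutPow, pow_one]
  simp [cutPow, ← h.map_star 1 one_mem_eigenspace, h.mul_map_one]
  rw [← mul_assoc, h.map_one_mul_map hν, ← h.mul_star_self, mul_assoc, h.star_mul_self,
    h.mul_map_one]

end IsCovariantPair

/-- Writing `x = (xν*)ν` lowers a positive degree by one; negative degrees follow by adjoints, and
the rest by density. -/
theorem hom_ext {γ : CircleAction M} {ν : M} (hν : star ν * ν = 1) (hmem : ν ∈ γ.eigenspace 1)
    {f g : M →⋆ₙₐ[ℂ] B} (h0 : ∀ x ∈ γ.eigenspace 0, f x = g x) (h1 : f ν = g ν) : f = g := by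
  have hf : ∀ f : M →⋆ₙₐ[ℂ] B, Continuous f := fun f =>
    AddMonoidHomClass.continuous_of_bound f 1
      (fun x => by rw [one_mul]; exact NonUnitalStarAlgHom.norm_apply_le f x)
  have key : ∀ (n : ℕ), ∀ x ∈ γ.eigenspace n, f x = g x := by
    intro n
    induction n with
    | zero => exact fun x hx => h0 x (by simpa using hx)
    | succ n ih =>
      intro x hx
      have hx' : x * star ν ∈ γ.eigenspace n := by
        have := mul_mem_eigenspace hx (star_mem_eigenspace hmem)
        rwa [show ((n + 1 : ℕ) : ℤ) + -1 = n by push_cast; ring] at this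
      have hxx : x = x * star ν * ν := by rw [mul_assoc, hν, mul_one]
      rw [hxx, map_mul f (x * star ν), map_mul g (x * star ν), ih _ hx', h1]
  refine NonUnitalStarAlgHom.ext fun x => ?_
  induction x using γ.closed_induction with
  | hC => exact isClosed_eq (hf f) (hf g)
  | h n x hx =>
    induction hx using Submodule.span_induction with
    | zero => rw [map_zero, map_zero]
    | add x y _ _ hx hy => rw [map_add, map_add, hx, hy]
    | smul c x _ hx => rw [map_smul, map_smul, hx]
    | mem x hx =>
      obtain ⟨k, -, hx⟩ := hx
      obtain ⟨n, rfl | rfl⟩ := k.eq_nat_or_neg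
      · exact key n x hx
      · have := key n (star x) (by simpa using star_mem_eigenspace hx)
        rwa [map_star, map_star, star_inj] at this

end CircleAction

end

noncomputable section

open scoped TensorProduct

/-! ### Functoriality of the minimal tensor product in its left factor. -/

namespace MinTensor

variable {A A' : Type*} {B : Type*} [CStarAlgebra A] [CStarAlgebra A'] [CStarAlgebra B]

/-- The homomorphism `f ⊗ id` on algebraic tensor products. -/
def algMapLeft (B : Type*) [CStarAlgebra B] (f : A →⋆ₐ[ℂ] A') : A ⊗[ℂ] B →⋆ₐ[ℂ] A' ⊗[ℂ] B where
  __ := Algebra.TensorProduct.map (f : A →ₐ[ℂ] A') (AlgHom.id ℂ B)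
  map_star' x := by
    change Algebra.TensorProduct.map (f : A →ₐ[ℂ] A') (AlgHom.id ℂ B) (star x) =
      star (Algebra.TensorProduct.map (f : A →ₐ[ℂ] A') (AlgHom.id ℂ B) x)
    induction x using TensorProduct.induction_on with
    | zero => rw [star_zero, map_zero, star_zero]
    | tmul a b =>
      rw [TensorProduct.star_tmul, Algebra.TensorProduct.map_tmul, Algebra.TensorProduct.map_tmul,
        TensorProduct.star_tmul]
      exact congrArg (· ⊗ₜ[ℂ] star b) (map_star f a)
    | add x y hx hy => rw [star_add, map_add, hx, hy, map_add, star_add]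

theorem algMapLeft_tmul (f : A →⋆ₐ[ℂ] A') (a : A) (b : B) :
    algMapLeft B f (a ⊗ₜ b) = f a ⊗ₜ b := Algebra.TensorProduct.map_tmul _ _ _ _

end MinTensor

namespace MinTensor

universe v

variable {A A' : Type v} {B : Type u} [CStarAlgebra A] [CStarAlgebra A'] [CStarAlgebra B]

/-- A representation of `A'` pulls back along `f` to one of `A`, so each seminorm in the supremum on
the left also occurs on the right. -/
theorem spatialSeminorm_algMapLeft_le (f : A →⋆ₐ[ℂ] A') (x : A ⊗[ℂ] B) :
    spatialSeminorm A' B (algMapLeft B f x) ≤ spatialSeminorm A B x := by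
  refine CStarSeminorm.sup_le _ (CStarSeminorm.nonneg _ _) ?_
  rintro q ⟨H, _, _, _, K, _, _, _, π, σ, rfl⟩
  have h : prodRep₀ π σ (algMapLeft B f x) = prodRep₀ (π.comp f) σ x := by
    induction x using TensorProduct.induction_on with
    | zero => simp
    | tmul a b => rw [algMapLeft_tmul, prodRep₀_tmul, prodRep₀_tmul]; rfl
    | add x y hx hy => rw [map_add, map_add, hx, hy, map_add]
  rw [CStarSeminorm.ofHom_apply, h]
  exact CStarSeminorm.le_sup spatialSeminorms_bddAbove
    (q := CStarSeminorm.ofHom (prodRep₀ (π.comp f) σ)) ⟨H, _, _, _, K, _, _, _, _, σ, rfl⟩ x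

/-- The homomorphism `f ⊗ id` on minimal tensor products. -/
def mapLeft (B : Type u) [CStarAlgebra B] (f : A →⋆ₐ[ℂ] A') : MinTensor A B →⋆ₐ[ℂ] MinTensor A' B :=
  CStarCompletion.lift ((of A' B).comp (algMapLeft B f)) fun x =>
    (CStarCompletion.norm_of (spatialSeminorm A' B) _).trans_le (spatialSeminorm_algMapLeft_le f x)

theorem mapLeft_tmul (f : A →⋆ₐ[ℂ] A') (a : A) (b : B) :
    mapLeft B f (tmul a b) = tmul (f a) b := by
  refine (CStarCompletion.lift_of _ _ (a ⊗ₜ[ℂ] b)).trans ?_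
  rw [StarAlgHom.comp_apply, algMapLeft_tmul]; rfl

theorem smul_tmul (c : ℂ) (a : A) (b : B) : tmul (c • a) b = c • tmul a b := by
  rw [tmul, ← TensorProduct.smul_tmul', map_smul]; rfl

theorem tmul_smul (c : ℂ) (a : A) (b : B) : tmul a (c • b) = c • tmul a b := by
  rw [tmul, TensorProduct.tmul_smul, map_smul]; rfl

theorem tmul_sum {ι : Type*} (s : Finset ι) (a : A) (b : ι → B) :
    tmul a (∑ i ∈ s, b i) = ∑ i ∈ s, tmul a (b i) := by
  rw [tmul, TensorProduct.tmul_sum, map_sum]; rfl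

theorem sum_tmul {ι : Type*} (s : Finset ι) (a : ι → A) (b : B) :
    tmul (∑ i ∈ s, a i) b = ∑ i ∈ s, tmul (a i) b := by
  rw [tmul, TensorProduct.sum_tmul, map_sum]; rfl

end MinTensor

/-! ### The gauge action on `𝒪_d` and on the fixed point algebra. -/

namespace CuntzAlgebra

variable {d : ℕ}

theorem gauge_mul_apply (z w : Circle) (x : CuntzAlgebra d) :
    gauge (z * w) x = gauge z (gauge w x) := by
  have h : (gauge (z * w) : CuntzAlgebra d →⋆ₐ[ℂ] _) = (gauge z).comp (gauge w) :=
    hom_ext fun i => by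
      rw [StarAlgHom.comp_apply, UnitaryRep.gauge_S, UnitaryRep.gauge_S, map_smul,
        UnitaryRep.gauge_S, smul_smul, Circle.coe_mul, mul_comm]
  exact DFunLike.congr_fun h x

theorem gauge_one_apply (x : CuntzAlgebra d) : gauge 1 x = x := by
  have h : (gauge 1 : CuntzAlgebra d →⋆ₐ[ℂ] _) = StarAlgHom.id ℂ _ :=
    hom_ext fun i => by simp [UnitaryRep.gauge_S]
  exact DFunLike.congr_fun h x

theorem continuous_gauge_of (x : FreeStarAlg (Fin d)) :
    Continuous fun z : Circle => gauge z (of d x) := by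
  induction x using FreeStarAlg.induction with
  | h0 r =>
    have : (fun z : Circle => gauge z (of d (algebraMap ℂ _ r))) =
        fun _ => algebraMap ℂ (CuntzAlgebra d) r := funext fun z => by
      rw [AlgHomClass.commutes, AlgHomClass.commutes]
    rw [this]; exact continuous_const
  | h1 s =>
    have hS (i : Fin d) : Continuous fun z : Circle => gauge z (S i : CuntzAlgebra d) := by
      simp only [UnitaryRep.gauge_S]
      exact (Continuous.subtype_val continuous_id).smul continuous_const
    cases s with
    | inl i => exact hS i
    | inr i =>
      have : FreeStarAlg.letter (Sum.inr i) = star (FreeStarAlg.gen i) :=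
        (FreeStarAlg.star_letter (Sum.inl i)).symm
      simp only [this, map_star]
      exact (hS i).star
  | hm a b ha hb => simp only [map_mul]; exact ha.mul hb
  | ha a b ha hb => simp only [map_add]; exact ha.add hb

/-- The maps `gauge z` are all contractive, so approximating `x` by `*`-polynomials approximates its
orbit uniformly in `z`. -/
theorem continuous_gauge (x : CuntzAlgebra d) : Continuous fun z : Circle => gauge z x := by
  refine continuous_of_uniform_approx_of_continuous fun u hu => ?_
  obtain ⟨ε, hε, hu⟩ := Metric.mem_uniformity_dist.1 hu
  obtain ⟨y, hy⟩ := (CStarCompletion.denseRange_of (cuntzSeminorm d)).exists_dist_lt x hε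
  refine ⟨fun z => gauge z (of d y), continuous_gauge_of y, fun z => hu ?_⟩
  rw [dist_eq_norm, ← map_sub]
  refine (NonUnitalStarAlgHom.norm_apply_le (gauge z) _).trans_lt ?_
  rw [← dist_eq_norm]
  exact hy

end CuntzAlgebra

namespace UnitaryRep

open CuntzAlgebra

variable {A : Type u} [CStarAlgebra A] {G : CompactQuantumGroup A} {d : ℕ} (α : UnitaryRep G d)

theorem coaction_S (i : Fin d) : α.coaction (S i) = ∑ j, MinTensor.tmul (S j) (α.mat j i) :=
  lift_S _ _ i

/-- Both sides are homomorphisms, so comparison on the generators is enough. This is why the gauge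
action preserves `𝒪_d^α`. -/
theorem coaction_gauge (z : Circle) (x : CuntzAlgebra d) :
    α.coaction (gauge z x) = MinTensor.mapLeft A (gauge z) (α.coaction x) := by
  have h : α.coaction.comp (gauge z) = (MinTensor.mapLeft A (gauge z)).comp α.coaction :=
    hom_ext fun i => by
      simp only [StarAlgHom.comp_apply, gauge_S, map_smul, coaction_S, map_sum,
        MinTensor.mapLeft_tmul, MinTensor.smul_tmul, Finset.smul_sum]
  exact DFunLike.congr_fun h x

theorem gauge_mem_fixedAlg (z : Circle) {x : CuntzAlgebra d} (hx : x ∈ α.fixedAlg) :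
    gauge z x ∈ α.fixedAlg := by
  rw [mem_fixedAlg] at hx ⊢
  rw [coaction_gauge, hx, MinTensor.mapLeft_tmul]

/-- The gauge action on the fixed point algebra `𝒪_d^α`. -/
def gaugeAction : CircleAction α.fixedAlg where
  toHom z := ((gauge z).comp α.fixedAlg.subtype).codRestrict α.fixedAlg
    fun x => α.gauge_mem_fixedAlg z x.2
  mul_apply z w x := Subtype.ext (gauge_mul_apply z w x.1)
  one_apply x := Subtype.ext (gauge_one_apply x.1)
  continuous_apply x := Continuous.subtype_mk (continuous_gauge x.1) _

variable {α}

theorem mem_eigenspace_gaugeAction {k : ℤ} {x : α.fixedAlg} :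
    x ∈ α.gaugeAction.eigenspace k ↔ ∀ z : Circle, gauge z x.1 = ((z ^ k : Circle) : ℂ) • x.1 :=
  forall_congr' fun _ => Subtype.ext_iff

theorem mem_eigenspace_zero {x : α.fixedAlg} :
    x ∈ α.gaugeAction.eigenspace 0 ↔ x.1 ∈ α.gaugeFixedAlg := by
  rw [mem_eigenspace_gaugeAction, mem_gaugeFixedAlg]
  simp

end UnitaryRep

/-! ### From compatible representations to covariant pairs, and the universal property. -/

namespace CStarCorrespondence

variable {A E : Type*} [CStarAlgebra A] [NormedAddCommGroup E] [NormedSpace ℂ E]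
  {X : CStarCorrespondence A E} {ι : Type*} [Fintype ι] {f : ι → E} {B : Type*}
  [NonUnitalCStarAlgebra B]

/-- Right linearity is not an axiom of compatible representations: it holds because the difference
`d` of the two sides has `d*d = 0`, computed through the inner product. -/
theorem CompatibleRep.t_mul_π (s : X.CompatibleRep f B) (ξ : E) (a : A) :
    s.t ξ * s.π a = s.t (X.rsmul ξ a) := by
  have h1 : ∀ η, X.inner (X.rsmul ξ a) η = star a * X.inner ξ η := fun η => by
    rw [← X.star_inner, X.inner_rsmul_right, star_mul, X.star_inner]
  have h0 : star (s.t ξ * s.π a - s.t (X.rsmul ξ a)) * (s.t ξ * s.π a - s.t (X.rsmul ξ a)) = 0 := by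
    rw [star_sub, star_mul, ← map_star]
    simp only [sub_mul, mul_sub, mul_assoc, s.star_t_mul_t]
    rw [← mul_assoc (star (s.t ξ)), ← mul_assoc (star (s.t (X.rsmul ξ a))), s.star_t_mul_t,
      s.star_t_mul_t]
    simp only [h1, X.inner_rsmul_right, ← map_mul, mul_assoc, sub_self]
  exact sub_eq_zero.1 (CStarRing.star_mul_self_eq_zero_iff _ |>.1 h0)

end CStarCorrespondence

namespace UnitaryRep.IsShiftIsometry

open CuntzAlgebra

variable {A : Type u} [CStarAlgebra A] {G : CompactQuantumGroup A} {d : ℕ} {α : UnitaryRep G d}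
  {N : ℕ} {ν : CuntzAlgebra d} {B : Type*} [NonUnitalCStarAlgebra B]

/-- The gauge-invariant part of an element of `𝒪_d^α`. -/
def expectation (α : UnitaryRep G d) (x : α.fixedAlg) : α.gaugeFixedAlg :=
  ⟨(α.gaugeAction.comp 0 x).1, mem_eigenspace_zero.1 (α.gaugeAction.comp_mem 0 x)⟩

/-- A representation of `ℱ^α`, composed with the projection of `𝒪_d^α` onto `ℱ^α`. -/
def expectationRep (α : UnitaryRep G d) (π : α.gaugeFixedAlg →⋆ₙₐ[ℂ] B) : α.fixedAlg →L[ℂ] B :=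
  LinearMap.mkContinuous
    { toFun := fun x => π (expectation α x)
      map_add' := fun x y => by
        rw [← map_add]
        exact congrArg π (Subtype.ext (congrArg (Subtype.val : α.fixedAlg → CuntzAlgebra d)
          (map_add (α.gaugeAction.comp 0) x y)))
      map_smul' := fun c x => by
        rw [RingHom.id_apply, ← map_smul]
        exact congrArg π
          (Subtype.ext (congrArg (Subtype.val : α.fixedAlg → CuntzAlgebra d)
            (map_smul (α.gaugeAction.comp 0) c x))) } 1
    (fun x => by
      rw [one_mul]
      exact (NonUnitalStarAlgHom.norm_apply_le π _).trans (α.gaugeAction.norm_comp_le 0 x))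

theorem norm_expectationRep_le (π : α.gaugeFixedAlg →⋆ₙₐ[ℂ] B) (x : α.fixedAlg) :
    ‖expectationRep α π x‖ ≤ ‖x‖ :=
  (NonUnitalStarAlgHom.norm_apply_le π _).trans (α.gaugeAction.norm_comp_le 0 x)

theorem expectationRep_apply (π : α.gaugeFixedAlg →⋆ₙₐ[ℂ] B) {x : α.fixedAlg}
    (hx : x.1 ∈ α.gaugeFixedAlg) : expectationRep α π x = π ⟨x.1, hx⟩ := by
  refine congrArg π (Subtype.ext (congrArg (Subtype.val : α.fixedAlg → CuntzAlgebra d)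
    ((α.gaugeAction.comp_of_mem (mem_eigenspace_zero.2 hx) 0).trans (if_pos rfl))))

theorem expectationRep_eq_zero (π : α.gaugeFixedAlg →⋆ₙₐ[ℂ] B) {k : ℤ} (hk : k ≠ 0)
    {x : α.fixedAlg} (hx : x ∈ α.gaugeAction.eigenspace k) : expectationRep α π x = 0 := by
  have : expectation α x = 0 := Subtype.ext (congrArg (Subtype.val : α.fixedAlg → CuntzAlgebra d)
    ((α.gaugeAction.comp_of_mem hx 0).trans (if_neg hk.symm)))
  exact (congrArg π this).trans (map_zero π)

theorem mem_eigenspace_one (hν : α.IsShiftIsometry N ν) :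
    (⟨ν, hν.mem_fixedAlg⟩ : α.fixedAlg) ∈ α.gaugeAction.eigenspace 1 :=
  mem_eigenspace_gaugeAction.2 fun z => by rw [zpow_one]; exact hν.gauge_eq z

theorem expectationRep_mul (π : α.gaugeFixedAlg →⋆ₙₐ[ℂ] B) {x y : α.fixedAlg}
    (hx : x.1 ∈ α.gaugeFixedAlg) (hy : y.1 ∈ α.gaugeFixedAlg) :
    expectationRep α π (x * y) = expectationRep α π x * expectationRep α π y := by
  rw [expectationRep_apply π hx, expectationRep_apply π hy, ← map_mul]
  exact expectationRep_apply π (mul_mem hx hy)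

theorem expectationRep_star (π : α.gaugeFixedAlg →⋆ₙₐ[ℂ] B) {x : α.fixedAlg}
    (hx : x.1 ∈ α.gaugeFixedAlg) : expectationRep α π (star x) = star (expectationRep α π x) := by
  rw [expectationRep_apply π hx, ← map_star]
  exact expectationRep_apply π (star_mem hx)

theorem expectationRep_one (π : α.gaugeFixedAlg →⋆ₙₐ[ℂ] B) : expectationRep α π 1 = π 1 :=
  expectationRep_apply (x := 1) π (one_mem α.gaugeFixedAlg)

/-- The isometry `ν`, as an element of `𝒪_d^α`. -/
def toFixedAlg (hν : α.IsShiftIsometry N ν) : α.fixedAlg := ⟨ν, hν.mem_fixedAlg⟩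

theorem star_frame_mul (hν : α.IsShiftIsometry N ν)
    (s : hν.correspondence.CompatibleRep hν.frame B) :
    s.t (hν.frame ()) * star (s.t (hν.frame ())) = s.π 1 := by
  have h := s.sum_frame
  rwa [Fintype.sum_unique] at h

theorem frame_star_mul (hν : α.IsShiftIsometry N ν)
    (s : hν.correspondence.CompatibleRep hν.frame B) :
    star (s.t (hν.frame ())) * s.t (hν.frame ()) =
      expectationRep α s.π (hν.toFixedAlg * star hν.toFixedAlg) := by
  have h1 : ν * star ν ∈ α.gaugeFixedAlg := by
    simpa using hν.star_mul_mem hν.star_mem_corrSpace hν.star_mem_corrSpace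
  have h2 : hν.correspondence.inner (hν.frame ()) (hν.frame ()) = ⟨ν * star ν, h1⟩ :=
    Subtype.ext (congrArg (· * star ν) (star_star ν))
  rw [s.star_t_mul_t, h2]
  exact (expectationRep_apply (x := hν.toFixedAlg * star hν.toFixedAlg) s.π h1).symm

/-- After taking adjoints both sides equal `t(x*ν*)`: the left one by left linearity, the right one
by right linearity and `ν*ν = 1`. -/
theorem star_frame_mul_map (hν : α.IsShiftIsometry N ν)
    (s : hν.correspondence.CompatibleRep hν.frame B) {x : α.fixedAlg}
    (hx : x.1 ∈ α.gaugeFixedAlg) :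
    star (s.t (hν.frame ())) * expectationRep α s.π x =
      expectationRep α s.π (hν.toFixedAlg * x * star hν.toFixedAlg) *
        star (s.t (hν.frame ())) := by
  have hc : ν * x.1 * star ν ∈ α.gaugeFixedAlg := by
    rw [mul_assoc]; exact hν.isometry_mul_mem (hν.mul_mem_left hx hν.star_mem_corrSpace)
  have h2 := expectationRep_apply (x := hν.toFixedAlg * x * star hν.toFixedAlg) s.π hc
  rw [h2, expectationRep_apply s.π hx, ← star_inj, star_mul, star_mul, star_star, ← map_star,
    ← map_star, s.π_mul_t, s.t_mul_π]
  refine congrArg s.t (Subtype.ext ?_)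
  change star x.1 * star ν = star ν * star (ν * x.1 * star ν)
  simp only [star_mul, star_star]
  rw [← mul_assoc (star ν) ν, hν.star_mul_self, one_mul]

/-- The frame vector `ν*` has degree `-1`, hence the adjoint: `t(ν*)*` is to be the image of `ν`.
The frame condition becomes `v*v = π(1)`. -/
theorem isCovariantPair (hν : α.IsShiftIsometry N ν)
    (s : hν.correspondence.CompatibleRep hν.frame B) :
    α.gaugeAction.IsCovariantPair hν.toFixedAlg (expectationRep α s.π)
      (star (s.t (hν.frame ()))) where
  isometry := Subtype.ext hν.star_mul_self
  mem := hν.mem_eigenspace_one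
  norm_le := norm_expectationRep_le s.π
  map_mul _ hx _ hy := expectationRep_mul s.π (mem_eigenspace_zero.1 hx) (mem_eigenspace_zero.1 hy)
  map_star _ hx := expectationRep_star s.π (mem_eigenspace_zero.1 hx)
  map_eigenspace _ hk _ hx := expectationRep_eq_zero s.π hk hx
  star_mul_self := by rw [star_star, hν.star_frame_mul, expectationRep_one]
  mul_star_self := by rw [star_star, hν.frame_star_mul]
  covariant _ hx := hν.star_frame_mul_map s (mem_eigenspace_zero.1 hx)

/-- Since `E = ν* ℱ^α`, a map with the right values on `ℱ^α` and at `ν` automatically has the right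
values on `E`. Conversely, `ν` is the adjoint of the frame vector, so the conditions on `Φ` fix it
on the data required by `CircleAction.hom_ext`. -/
theorem isCuntzPimsner (hν : α.IsShiftIsometry N ν) :
    CStarCorrespondence.IsCuntzPimsner.{w} hν.correspondence hν.frame hν.naturalRep := by
  intro B _ s
  have h := hν.isCovariantPair s
  refine ⟨h.hom, ⟨fun a => ?_, fun ξ => ?_⟩, fun Φ hΦ => ?_⟩
  · refine (h.hom_apply (mem_eigenspace_zero.2 ?_)).trans (expectationRep_apply s.π ?_)
    exacts [a.2, a.2]
  · obtain ⟨ξ, hξ⟩ := ξ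
    obtain ⟨a, ha, rfl⟩ := mem_corrSpace.1 hξ
    have ha' := ((α.mem_gaugeFixedAlg _).1 ha).1
    have h1 : hν.naturalRep.t ⟨star ν * a, hξ⟩ =
      star hν.toFixedAlg * ⟨a, ha'⟩ := rfl
    rw [h1, map_mul, map_star, h.hom_isometry, star_star,
      h.hom_apply (mem_eigenspace_zero.2 ha), expectationRep_apply s.π ha, s.t_mul_π]
    rfl
  · refine CircleAction.hom_ext h.isometry h.mem (fun x hx => ?_) ?_
    · rw [h.hom_apply hx, expectationRep_apply s.π (mem_eigenspace_zero.1 hx)]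
      exact hΦ.1 ⟨x.1, mem_eigenspace_zero.1 hx⟩
    · have h1 : hν.toFixedAlg = star (hν.naturalRep.t (hν.frame ())) :=
        Subtype.ext (star_star ν).symm
      rw [h.hom_isometry]
      exact (congrArg Φ h1).trans ((map_star Φ _).trans (congrArg star (hΦ.2 _)))

end UnitaryRep.IsShiftIsometry

end

noncomputable section

/-! ### Existence of the isometry: polar decomposition of an intertwiner. -/

namespace Matrix

open scoped ComplexOrder

/-- The inverse square root of `Tᴴ T`, as a polynomial in `Tᴴ T`. -/
theorem exists_polynomial_normalizing {m n : Type*} [Fintype m] [Fintype n] [DecidableEq m]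
    (T : Matrix n m ℂ) (hT : Function.Injective T.mulVec) :
    ∃ p : Polynomial ℝ, (Polynomial.aeval (Tᴴ * T) p)ᴴ * (Tᴴ * T) *
      Polynomial.aeval (Tᴴ * T) p = 1 := by
  have hpos : (Tᴴ * T).PosDef := Matrix.PosDef.conjTranspose_mul_self T hT
  have hH := hpos.isHermitian
  have hsa : IsSelfAdjoint (Tᴴ * T) := hH
  have hfin := Matrix.finite_real_spectrum (A := Tᴴ * T)
  let s := hfin.toFinset
  -- Interpolating `x ↦ x^{-1/2}` on the finite spectrum gives an honest polynomial, so that the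
  -- intertwining property will pass to its value at `Tᴴ * T`.
  let p := Lagrange.interpolate s id (fun x : ℝ => (√x)⁻¹)
  have hp : ∀ x ∈ spectrum ℝ (Tᴴ * T), p.eval x = (√x)⁻¹ := fun x hx =>
    Lagrange.eval_interpolate_at_node (s := s) (v := id) (fun x : ℝ => (√x)⁻¹) (fun _ _ _ _ h => h)
      (hfin.mem_toFinset.2 hx)
  refine ⟨p, ?_⟩
  have h1 : Polynomial.aeval (Tᴴ * T) p = cfc (fun x : ℝ => p.eval x) (Tᴴ * T) :=
    (cfc_polynomial p (Tᴴ * T) hsa).symm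
  have h2 : (Polynomial.aeval (Tᴴ * T) p)ᴴ = Polynomial.aeval (Tᴴ * T) p := by
    rw [h1]; exact cfc_predicate (R := ℝ) (fun x => p.eval x) (Tᴴ * T)
  have h3 : cfc (fun x : ℝ => p.eval x * x * p.eval x) (Tᴴ * T) = 1 := by
    rw [← cfc_one ℝ (Tᴴ * T) hsa]
    refine cfc_congr fun x hx => ?_
    have hx0 : 0 < x := by
      rw [hH.spectrum_real_eq_range_eigenvalues] at hx
      obtain ⟨i, rfl⟩ := hx
      exact hpos.eigenvalues_pos i
    rw [hp x hx, Pi.one_apply]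
    have := Real.sqrt_pos.2 hx0
    field_simp
    exact (Real.sq_sqrt hx0.le).symm
  rw [h2, ← h3, cfc_mul _ _ _ (by fun_prop) (by fun_prop),
    cfc_mul _ _ _ (by fun_prop) (by fun_prop), cfc_id' ℝ _ hsa, h1]

end Matrix

/-! ### Scalar matrices as elements of the Cuntz algebra. -/

namespace CuntzAlgebra

variable {d : ℕ}

theorem word_cons {k : ℕ} (i : Fin d) (I : Fin k → Fin d) :
    (word (Fin.cons i I : Fin (k + 1) → Fin d) : CuntzAlgebra d) = S i * word I := by
  simp [word, List.ofFn_succ]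

theorem exists_eq_cons {ι : Type*} {k : ℕ} (I : Fin (k + 1) → ι) :
    ∃ (i : ι) (J : Fin k → ι), I = Fin.cons i J :=
  ⟨I 0, Fin.tail I, (Fin.cons_self_tail I).symm⟩

theorem sum_cons {ι R : Type*} [Fintype ι] [AddCommMonoid R] {k : ℕ} (f : (Fin (k + 1) → ι) → R) :
    ∑ I, f I = ∑ i, ∑ I : Fin k → ι, f (Fin.cons i I) := by
  rw [← Fintype.sum_prod_type']
  exact (Fintype.sum_equiv (Fin.consEquiv fun _ => ι) _ _ fun _ => rfl).symm

theorem star_word_mul_word {k : ℕ} (I J : Fin k → Fin d) :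
    star (word I : CuntzAlgebra d) * word J = if I = J then 1 else 0 := by
  induction k with
  | zero => simp [word, Subsingleton.elim I J]
  | succ k ih =>
    obtain ⟨i, I, rfl⟩ := exists_eq_cons I
    obtain ⟨j, J, rfl⟩ := exists_eq_cons J
    rw [word_cons, word_cons, star_mul, mul_assoc, ← mul_assoc (star (S i)),
      isCuntzFamily_S.star_mul]
    by_cases hij : i = j
    · rw [if_pos hij, one_mul, ih]
      simp [Fin.cons_inj, hij]
    · simp [Fin.cons_inj, hij]

theorem sum_word_mul_star (k : ℕ) :
    ∑ I : Fin k → Fin d, word I * star (word I : CuntzAlgebra d) = 1 := by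
  induction k with
  | zero => simp [word]
  | succ k ih =>
    rw [sum_cons, ← isCuntzFamily_S.sum_mul_star]
    refine Finset.sum_congr rfl fun i _ => ?_
    simp only [word_cons, star_mul, ← mul_assoc]
    simp only [mul_assoc (S i), ← Finset.sum_mul, ← Finset.mul_sum, ih, one_mul]

/-- The element of `ℋ^l (ℋ*)^k` with the matrix `V`. -/
def ofMatrix {l k : ℕ} (V : Matrix (Fin l → Fin d) (Fin k → Fin d) ℂ) : CuntzAlgebra d :=
  ∑ I, ∑ J, V I J • (word I * star (word J))

theorem ofMatrix_mem_hSpace {l k : ℕ} (V : Matrix (Fin l → Fin d) (Fin k → Fin d) ℂ) :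
    ofMatrix V ∈ hSpace d l k :=
  sum_mem fun I _ => sum_mem fun J _ => Submodule.smul_mem _ _ (Submodule.subset_span ⟨(I, J), rfl⟩)

theorem star_ofMatrix {l k : ℕ} (V : Matrix (Fin l → Fin d) (Fin k → Fin d) ℂ) :
    star (ofMatrix V) = ofMatrix V.conjTranspose := by
  simp only [ofMatrix, star_sum, star_smul, star_mul, star_star, Matrix.conjTranspose_apply]
  exact Finset.sum_comm

/-- By orthonormality of words of equal length, the products `word I * star (word J)` multiply like
matrix units. -/
theorem ofMatrix_mul_ofMatrix {l k r : ℕ} (V : Matrix (Fin l → Fin d) (Fin k → Fin d) ℂ)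
    (W : Matrix (Fin k → Fin d) (Fin r → Fin d) ℂ) :
    ofMatrix V * ofMatrix W = ofMatrix (V * W) := by
  have h : ∀ I J K L, (V I J • (word I * star (word J : CuntzAlgebra d))) *
      (W K L • (word K * star (word L))) =
      if J = K then (V I J * W K L) • (word I * star (word L)) else 0 := fun I J K L => by
    rw [smul_mul_smul_comm, mul_assoc, ← mul_assoc (star (word J)), star_word_mul_word]
    split_ifs <;> simp
  simp only [ofMatrix, Finset.sum_mul_sum, h]
  refine Finset.sum_congr rfl fun I _ => ?_
  simp only [Matrix.mul_apply, Finset.sum_smul]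
  rw [Finset.sum_comm (s := Finset.univ (α := Fin r → Fin d))]
  refine Finset.sum_congr rfl fun K _ => ?_
  rw [Finset.sum_comm]
  simp only [Finset.sum_ite_eq', Finset.mem_univ, if_true]

theorem ofMatrix_one (k : ℕ) : ofMatrix (1 : Matrix (Fin k → Fin d) (Fin k → Fin d) ℂ) = 1 := by
  rw [← sum_word_mul_star k]
  refine Finset.sum_congr rfl fun I _ => ?_
  simp [Matrix.one_apply]

end CuntzAlgebra

/-! ### Tensor powers, intertwiners and fixed points. -/

namespace UnitaryRep

open CuntzAlgebra Matrix

variable {A : Type u} [CStarAlgebra A] {G : CompactQuantumGroup A} {d : ℕ} (α : UnitaryRep G d)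

theorem tensorPow_cons {k : ℕ} (i j : Fin d) (I J : Fin k → Fin d) :
    α.tensorPow (k + 1) (Fin.cons i I) (Fin.cons j J) = α.mat i j * α.tensorPow k I J := by
  simp [tensorPow, List.ofFn_succ]

theorem tensorPow_zero : α.tensorPow 0 = 1 := by
  ext I J
  simp [tensorPow, Matrix.one_apply, Subsingleton.elim I J]

theorem conjTranspose_tensorPow_mul (k : ℕ) : (α.tensorPow k)ᴴ * α.tensorPow k = 1 := by
  induction k with
  | zero => simp [tensorPow_zero]
  | succ k ih =>
    ext I J
    obtain ⟨i, I, rfl⟩ := exists_eq_cons I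
    obtain ⟨j, J, rfl⟩ := exists_eq_cons J
    have h := congrFun (congrFun ih I) J
    simp only [Matrix.mul_apply, conjTranspose_apply] at h ⊢
    -- The entries do not commute: here the two first-letter factors are adjacent, so the first
    -- letter has to be summed innermost.
    rw [sum_cons, Finset.sum_comm]
    simp only [tensorPow_cons, star_mul, mul_assoc]
    simp only [← mul_assoc (star (α.mat _ _)), ← Finset.mul_sum, ← Finset.sum_mul, α.sum_star_mul]
    by_cases hij : i = j
    · simp [hij, h, Matrix.one_apply, Fin.cons_inj]
    · simp [hij, Fin.cons_inj]

theorem tensorPow_mul_conjTranspose (k : ℕ) : α.tensorPow k * (α.tensorPow k)ᴴ = 1 := by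
  induction k with
  | zero => simp [tensorPow_zero]
  | succ k ih =>
    ext I J
    obtain ⟨i, I, rfl⟩ := exists_eq_cons I
    obtain ⟨j, J, rfl⟩ := exists_eq_cons J
    have h := congrFun (congrFun ih I) J
    simp only [Matrix.mul_apply, conjTranspose_apply] at h ⊢
    -- Here the tail factors are the adjacent ones, so the tail is summed first, opposite to the
    -- previous case.
    rw [sum_cons]
    simp only [tensorPow_cons, star_mul, mul_assoc]
    simp only [← mul_assoc (α.tensorPow _ _ _), ← Finset.mul_sum, ← Finset.sum_mul, h]
    by_cases hIJ : I = J
    · simp [hIJ, α.sum_mul_star, Matrix.one_apply, Fin.cons_inj]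
    · simp [hIJ, Fin.cons_inj]

theorem coaction_word {k : ℕ} (I : Fin k → Fin d) :
    α.coaction (word I) = ∑ J, MinTensor.tmul (word J) (α.tensorPow k J I) := by
  induction k with
  | zero => simp [word, tensorPow, MinTensor.one_tmul_one]
  | succ k ih =>
    obtain ⟨i, I, rfl⟩ := exists_eq_cons I
    rw [word_cons, map_mul, ih, coaction_S, sum_cons, Finset.sum_mul_sum]
    simp only [MinTensor.tmul_mul_tmul, word_cons, tensorPow_cons]

/-- On matrices the coaction is conjugation by tensor powers, which turns invariance into an
identity between matrices over `C(𝔾)`. -/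
theorem coaction_ofMatrix {l k : ℕ} (V : Matrix (Fin l → Fin d) (Fin k → Fin d) ℂ) :
    α.coaction (ofMatrix V) = ∑ K, ∑ L, MinTensor.tmul (word K * star (word L))
      ((α.tensorPow l * V.map (algebraMap ℂ A) * (α.tensorPow k)ᴴ) K L) := by
  have h : ∀ K L, (α.tensorPow l * V.map (algebraMap ℂ A) * (α.tensorPow k)ᴴ) K L =
      ∑ I, ∑ J, V I J • (α.tensorPow l K I * star (α.tensorPow k L J)) := fun K L => by
    simp only [Matrix.mul_apply, Finset.sum_mul, Matrix.map_apply, conjTranspose_apply]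
    rw [Finset.sum_comm]
    refine Finset.sum_congr rfl fun I _ => Finset.sum_congr rfl fun J _ => ?_
    rw [← Algebra.commutes, ← Algebra.smul_def, smul_mul_assoc]
  simp only [h, MinTensor.tmul_sum, MinTensor.tmul_smul]
  simp only [ofMatrix, map_sum, map_smul, map_mul, map_star, coaction_word, star_sum,
    Finset.sum_mul_sum, MinTensor.star_tmul, MinTensor.tmul_mul_tmul, Finset.smul_sum]
  refine (Finset.sum_congr rfl fun I _ => Finset.sum_comm).trans (Finset.sum_comm.trans ?_)
  refine Finset.sum_congr rfl fun K _ => ?_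
  exact (Finset.sum_congr rfl fun I _ => Finset.sum_comm).trans Finset.sum_comm

variable {α}

/-- Intertwining and unitarity give `α^l V (α^k)* = V α^k (α^k)* = V`. -/
theorem ofMatrix_mem_fixedAlg {l k : ℕ} {V : Matrix (Fin l → Fin d) (Fin k → Fin d) ℂ}
    (hV : Intertwines V (α.tensorPow k) (α.tensorPow l)) : ofMatrix V ∈ α.fixedAlg := by
  rw [mem_fixedAlg, coaction_ofMatrix, ← hV, Matrix.mul_assoc, tensorPow_mul_conjTranspose,
    Matrix.mul_one, ofMatrix]
  simp only [MinTensor.sum_tmul, Matrix.map_apply, Algebra.algebraMap_eq_smul_one,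
    MinTensor.tmul_smul, MinTensor.smul_tmul]

section Intertwiners

variable {m n r : Type*} [Fintype m] [Fintype n] [Fintype r]
  {β : Matrix m m A} {β' : Matrix n n A} {β'' : Matrix r r A}

theorem Intertwines.comp {T : Matrix n m ℂ} {R : Matrix r n ℂ} (hR : Intertwines R β' β'')
    (hT : Intertwines T β β') : Intertwines (R * T) β β'' := by
  unfold Intertwines at *
  rw [Matrix.map_mul, Matrix.mul_assoc, hT, ← Matrix.mul_assoc, hR, Matrix.mul_assoc]

/-- Take adjoints in `Tβ = β'T`, then multiply by `β` on the left and by `β'` on the right. -/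
theorem Intertwines.conjTranspose [DecidableEq m] [DecidableEq n] {T : Matrix n m ℂ}
    (hT : Intertwines T β β') (hβ : β * βᴴ = 1) (hβ' : β'ᴴ * β' = 1) : Intertwines Tᴴ β' β := by
  unfold Intertwines at *
  have hs : Tᴴ.map (algebraMap ℂ A) = (T.map (algebraMap ℂ A))ᴴ := by
    ext i j; exact algebraMap_star_comm _
  have h := congrArg Matrix.conjTranspose hT
  rw [conjTranspose_mul, conjTranspose_mul] at h
  rw [hs]
  calc _ = β * (βᴴ * (T.map (algebraMap ℂ A))ᴴ) * β' := by
        rw [← Matrix.mul_assoc, hβ, Matrix.one_mul]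
    _ = _ := by rw [h, Matrix.mul_assoc, Matrix.mul_assoc, hβ', Matrix.mul_one]

/-- The self-intertwiners of `β` form a real subalgebra, which contains every real polynomial in
each of its elements. -/
theorem Intertwines.aeval [DecidableEq m] {T : Matrix m m ℂ} (hT : Intertwines T β β)
    (p : Polynomial ℝ) :
    Intertwines (Polynomial.aeval T p) β β := by
  let C : Subalgebra ℝ (Matrix m m ℂ) :=
    { carrier := {R | Intertwines R β β}
      mul_mem' := Intertwines.comp
      add_mem' := fun {a b} ha hb => by
        change Intertwines _ _ _
        unfold Intertwines at *
        rw [Matrix.map_add _ (map_add _), Matrix.add_mul, Matrix.mul_add, ha, hb]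
      algebraMap_mem' := fun r => by
        change Intertwines _ _ _
        unfold Intertwines
        have : (algebraMap ℝ (Matrix m m ℂ) r).map (algebraMap ℂ A) = (r : ℂ) • 1 := by
          ext i j
          by_cases hij : i = j <;> simp [Algebra.algebraMap_eq_smul_one, hij]
        rw [this, Matrix.smul_mul, Matrix.mul_smul, Matrix.one_mul, Matrix.mul_one] }
  exact Algebra.adjoin_le (S := C) (Set.singleton_subset_iff.2 hT)
    (Polynomial.aeval_mem_adjoin_singleton ℝ T)

end Intertwiners

theorem exists_isShiftIsometry {N : ℕ}
    (hα : IsContainedIn (α.tensorPow N) (α.tensorPow (N + 1))) :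
    ∃ ν : CuntzAlgebra d, α.IsShiftIsometry N ν := by
  obtain ⟨T, hT, hinj⟩ := hα
  obtain ⟨p, hp⟩ := T.exists_polynomial_normalizing hinj
  -- `Tᴴ * T` intertwines `α^N` with itself, so its inverse square root does as well.
  have hH := (hT.conjTranspose (α.tensorPow_mul_conjTranspose N)
    (α.conjTranspose_tensorPow_mul (N + 1))).comp hT
  refine ⟨ofMatrix (T * Polynomial.aeval (Tᴴ * T) p), ?_, ofMatrix_mem_hSpace _,
    ofMatrix_mem_fixedAlg (hT.comp (hH.aeval p))⟩
  rw [star_ofMatrix, ofMatrix_mul_ofMatrix, conjTranspose_mul, ← Matrix.mul_assoc,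
    Matrix.mul_assoc _ Tᴴ, hp, ofMatrix_one]

end UnitaryRep

end

/-- If `α^N` is contained in `α^{N+1}`, then there is an isometry `ν ∈ ℋ^{N+1} (ℋ*)^N ∩ 𝒪_d^α`, and
for every such `ν` the algebra `𝒪_d^α` is the Cuntz-Pimsner algebra of the natural C*-correspondence
`E = ν* ℱ^α` over `ℱ^α`. -/
theorem mainTheorem4 {A : Type u} [CStarAlgebra A] (G : CompactQuantumGroup A) (d : ℕ)
    (α : UnitaryRep G d) (N : ℕ)
    (hα : UnitaryRep.IsContainedIn (α.tensorPow N) (α.tensorPow (N + 1))) :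
    (∃ ν : CuntzAlgebra d, α.IsShiftIsometry N ν) ∧
      ∀ (ν : CuntzAlgebra d) (hν : α.IsShiftIsometry N ν),
        hν.correspondence.IsFrame hν.frame ∧
          CStarCorrespondence.IsCuntzPimsner.{w} hν.correspondence hν.frame hν.naturalRep :=
  ⟨UnitaryRep.exists_isShiftIsometry hα, fun _ hν => ⟨hν.isFrame, hν.isCuntzPimsner⟩⟩
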